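/- Let $\mu$ be the Möbius function, $\zeta$ the Riemann zeta function, and $M(x)=\sum_{1\le n\le x}\mu(n)$ for real $x$. Let $\tfrac12\le\eta<1$. Then the following are equivalent: (i) $\zeta(s)$ has no zeros with $\operatorname{Re}(s)>\eta$; (ii) for every $\varepsilon>0$, $M(x)=O(x^{\eta+\varepsilon})$ as $x\to\infty$; (iii) for every $\varepsilon>0$, $\sum_{n\ge1}\mu(n)z^n=O\big((1-z)^{-(\eta+\varepsilon)}\big)$ as $z\to1^-$ in $\mathbb{R}$. The constants implied by $O$ may depend on $\eta$ and $\varepsilon$. -/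

import Mathlib

open Filter Topology Asymptotics

/-- The Mertens function `M(x) = ∑_{n ≤ x} μ(n)` of a real variable `x`, the sum being over the
positive integers `n ≤ x`. -/
noncomputable def mertens (x : ℝ) : ℝ := ∑ n ∈ Finset.Icc 1 ⌊x⌋₊, (ArithmeticFunction.moebius n : ℝ)

/-- The power series `∑_{n ≥ 1} μ(n) z^n` at real `z`. Mathlib's `μ` has `μ(0) = 0`. -/
noncomputable def moebiusPowerSeries (z : ℝ) : ℝ :=
  ∑' n : ℕ, (ArithmeticFunction.moebius n : ℝ) * z ^ n

/-- The series converges absolutely for `|z| < 1`, so its value there is the true sum. -/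
theorem moebiusPowerSeries_hasSum {z : ℝ} (hz : |z| < 1) :
    HasSum (fun n : ℕ => (ArithmeticFunction.moebius n : ℝ) * z ^ n) (moebiusPowerSeries z) := by
  refine Summable.hasSum (Summable.of_norm_bounded
    (summable_geometric_of_lt_one (abs_nonneg z) hz) fun n => ?_)
  rw [norm_mul, norm_pow, Real.norm_eq_abs, Real.norm_eq_abs]
  have h : |(ArithmeticFunction.moebius n : ℝ)| ≤ 1 := by
    exact_mod_cast ArithmeticFunction.abs_moebius_le_one
  calc _ ≤ 1 * |z| ^ n := by gcongr
    _ = _ := one_mul _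

/-! Everything rests on `∑ μ(n) n^{-s} = 1/ζ(s)`. Write `P(z) = ∑ μ(n) z^n`.

(ii) ⇒ (iii): Abel summation gives `P(z) = (1 - z) ∑ M(n) z^n`, and `M(n) = O(n^a)` is summed
against geometric series.

(iii) ⇒ (i): the Mellin transform of `P(e^{-t})` is `Γ(s)/ζ(s)` for `Re s > 1`. The growth bound
makes it holomorphic for `Re s > η`, and since `Γ` never vanishes, neither does `ζ` there.

(i) ⇒ (ii) is Littlewood's argument. On discs centred at `2 + it` that stay in the zero-free region,
Borel–Carathéodory bounds a logarithm of `ζ`, with the pole removed, by `O(log |t|)` for large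
`|t|`. Near the centre it is `O(1)`, so three circles improve the bound to `O((log |t|)^θ)` with `θ
< 1`, whence `1/ζ = O(|t|^ε)` (`exists_norm_sub_one_div_riemannZeta₁_le`). Mellin inversion writes
`∑_{n ≤ N} μ(n)(N - n)` as an absolutely convergent integral of `1/ζ`; its difference between `N +
1` and `N` is exactly `M(N)`. Moving the line to `Re s = σ > η` bounds `M(N)` by `N^{σ+κ}`. -/

theorem abs_moebius_cast_le_one (n : ℕ) : |(ArithmeticFunction.moebius n : ℝ)| ≤ 1 := by
  exact_mod_cast ArithmeticFunction.abs_moebius_le_one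

/-! ### From the Mertens function to the power series -/

theorem mertens_natCast_succ (n : ℕ) :
    mertens ((n + 1 : ℕ) : ℝ) = mertens (n : ℝ) + ArithmeticFunction.moebius (n + 1) := by
  simp only [mertens, Nat.floor_natCast]
  exact Finset.sum_Icc_succ_top (by omega) _

theorem abs_mertens_natCast_le (n : ℕ) : |mertens (n : ℝ)| ≤ n := by
  induction n with
  | zero => simp [mertens]
  | succ n ih =>
    rw [mertens_natCast_succ]
    refine (abs_add_le _ _).trans ?_
    push_cast
    exact add_le_add ih (abs_moebius_cast_le_one _)

theorem summable_mertens_mul_pow {z : ℝ} (hz : |z| < 1) :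
    Summable fun n : ℕ => mertens (n : ℝ) * z ^ n := by
  have h := (hasSum_coe_mul_geometric_of_norm_lt_one
    (by simpa using hz : ‖(|z| : ℝ)‖ < 1)).summable
  refine h.of_norm_bounded fun n => ?_
  rw [norm_mul, norm_pow, Real.norm_eq_abs, Real.norm_eq_abs]
  exact mul_le_mul_of_nonneg_right (abs_mertens_natCast_le n) (by positivity)

/-- Abel summation for the power series of the Möbius function. -/
theorem moebiusPowerSeries_eq_one_sub_mul {z : ℝ} (hz : |z| < 1) :
    moebiusPowerSeries z = (1 - z) * ∑' n : ℕ, mertens (n : ℝ) * z ^ n := by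
  have hS := (summable_mertens_mul_pow hz).hasSum
  set S := ∑' n : ℕ, mertens (n : ℝ) * z ^ n
  have h1 : HasSum (fun n : ℕ => mertens ((n + 1 : ℕ) : ℝ) * z ^ (n + 1)) S := by
    have := (hasSum_nat_add_iff' 1).mpr hS
    simpa [mertens] using this
  have h2 : HasSum (fun n : ℕ => (ArithmeticFunction.moebius (n + 1) : ℝ) * z ^ (n + 1))
      (moebiusPowerSeries z) := by
    have := (hasSum_nat_add_iff' 1).mpr (moebiusPowerSeries_hasSum hz)
    simpa using this
  have e : (fun n : ℕ => (ArithmeticFunction.moebius (n + 1) : ℝ) * z ^ (n + 1)) =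
      fun n : ℕ => mertens ((n + 1 : ℕ) : ℝ) * z ^ (n + 1) - z * (mertens (n : ℝ) * z ^ n) := by
    funext n
    rw [mertens_natCast_succ]
    ring
  rw [e] at h2
  rw [one_sub_mul]
  exact h2.unique (h1.sub (hS.mul_left z))

/-- With `y = x / N`, `y ^ a ≤ max 1 y`. The affine majorant has an elementary generating series. -/
theorem rpow_le_rpow_mul_one_add_div {a x N : ℝ} (ha : 0 ≤ a) (ha1 : a ≤ 1) (hx : 0 ≤ x)
    (hN : 0 < N) : x ^ a ≤ N ^ a * (1 + x / N) := by
  have key : (x / N) ^ a ≤ 1 + x / N := by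
    have h0 : 0 ≤ x / N := by positivity
    rcases le_total (x / N) 1 with h | h
    · linarith [Real.rpow_le_one h0 h ha]
    · have := Real.rpow_le_rpow_of_exponent_le h ha1
      rw [Real.rpow_one] at this
      linarith
  calc x ^ a = (N * (x / N)) ^ a := by rw [mul_div_cancel₀ _ hN.ne']
    _ = N ^ a * (x / N) ^ a := Real.mul_rpow hN.le (by positivity)
    _ ≤ _ := by gcongr

/-- At the scale `N = 1/(1 - z)`, both `∑ z^n` and `N⁻¹ ∑ n z^n` are at most `N`; the Abel factor `1
- z` cancels that power. -/
theorem abs_moebiusPowerSeries_le {a C z : ℝ} (ha : 0 ≤ a) (ha1 : a ≤ 1) (hC : 0 ≤ C)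
    (hM : ∀ n : ℕ, |mertens (n : ℝ)| ≤ C * (n : ℝ) ^ a) (hz0 : 0 ≤ z) (hz1 : z < 1) :
    |moebiusPowerSeries z| ≤ 2 * C * (1 - z) ^ (-a) := by
  have hz : |z| < 1 := by rwa [abs_of_nonneg hz0]
  have h1z : 0 < 1 - z := by linarith
  set N := (1 - z)⁻¹ with hN
  have hN0 : 0 < N := inv_pos.mpr h1z
  have hg := hasSum_geometric_of_lt_one hz0 hz1
  have hg' : HasSum (fun n : ℕ => (n : ℝ) * z ^ n) (z / (1 - z) ^ 2) :=
    hasSum_coe_mul_geometric_of_norm_lt_one hz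
  have hsum := (hg.add (hg'.mul_left N⁻¹)).mul_left (C * N ^ a)
  have hb : ‖∑' n : ℕ, mertens (n : ℝ) * z ^ n‖ ≤ C * N ^ a * (N + N⁻¹ * (z / (1 - z) ^ 2)) := by
    refine tsum_of_norm_bounded hsum fun n => ?_
    rw [norm_mul, norm_pow, Real.norm_eq_abs, Real.norm_eq_abs, abs_of_nonneg hz0]
    have h1 : |mertens (n : ℝ)| ≤ C * (N ^ a * (1 + n / N)) := (hM n).trans
      (mul_le_mul_of_nonneg_left (rpow_le_rpow_mul_one_add_div ha ha1 n.cast_nonneg hN0) hC)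
    calc |mertens (n : ℝ)| * z ^ n ≤ C * (N ^ a * (1 + n / N)) * z ^ n :=
          mul_le_mul_of_nonneg_right h1 (pow_nonneg hz0 n)
      _ = _ := by rw [div_eq_mul_inv]; ring
  rw [moebiusPowerSeries_eq_one_sub_mul hz, abs_mul, abs_of_pos h1z, Real.rpow_neg h1z.le,
    ← Real.inv_rpow h1z.le, ← hN]
  rw [Real.norm_eq_abs] at hb
  calc (1 - z) * |∑' n : ℕ, mertens (n : ℝ) * z ^ n|
      ≤ (1 - z) * (C * N ^ a * (N + N⁻¹ * (z / (1 - z) ^ 2))) := by gcongr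
    _ = (C * N ^ a) * ((1 - z) * N + ((1 - z) * N⁻¹ / (1 - z) ^ 2) * z) := by ring
    _ = (1 + z) * (C * N ^ a) := by
      have e1 : (1 - z) * N = 1 := mul_inv_cancel₀ h1z.ne'
      have e2 : (1 - z) * N⁻¹ / (1 - z) ^ 2 = 1 := by
        rw [hN, inv_inv, ← sq, div_self (by positivity)]
      rw [e1, e2]
      ring
    _ ≤ 2 * (C * N ^ a) := by gcongr; linarith
    _ = _ := by ring

theorem moebiusPowerSeries_isBigO_of_mertens_isBigO {a : ℝ} (ha : 0 < a) (ha1 : a ≤ 1)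
    (h : mertens =O[atTop] fun x : ℝ => x ^ a) :
    moebiusPowerSeries =O[𝓝[<] (1 : ℝ)] fun z : ℝ => (1 - z) ^ (-a) := by
  obtain ⟨C, hC, hb⟩ := bound_of_isBigO_nat_atTop (h.comp_tendsto tendsto_natCast_atTop_atTop)
  have hM : ∀ n : ℕ, |mertens (n : ℝ)| ≤ C * (n : ℝ) ^ a := by
    intro n
    rcases Nat.eq_zero_or_pos n with rfl | hn
    · simp [mertens, Real.zero_rpow ha.ne']
    · have hp : 0 < (n : ℝ) ^ a := by positivity
      have := hb (x := n) hp.ne'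
      simpa [abs_of_pos hp] using this
  refine IsBigO.of_bound (2 * C) ?_
  filter_upwards [Ioo_mem_nhdsLT (zero_lt_one : (0 : ℝ) < 1)] with z hz
  rw [Real.norm_eq_abs, Real.norm_eq_abs, abs_of_nonneg (Real.rpow_nonneg (by linarith [hz.2]) _)]
  exact abs_moebiusPowerSeries_le ha.le ha1 hC.le hM hz.1.le hz.2

theorem one_sub_rpow_neg_isBigO {a b : ℝ} (hab : a ≤ b) :
    (fun z : ℝ => (1 - z) ^ (-a)) =O[𝓝[<] (1 : ℝ)] fun z : ℝ => (1 - z) ^ (-b) := by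
  refine IsBigO.of_bound 1 ?_
  filter_upwards [Ioo_mem_nhdsLT (zero_lt_one : (0 : ℝ) < 1)] with z hz
  have h0 : 0 < 1 - z := by linarith [hz.2]
  rw [one_mul, Real.norm_of_nonneg (by positivity), Real.norm_of_nonneg (by positivity)]
  exact Real.rpow_le_rpow_of_exponent_ge h0 (by linarith [hz.1]) (by linarith)

/-! ### From the power series to the zeros of zeta, by Mellin transform -/

theorem abs_moebiusPowerSeries_le_div {z : ℝ} (hz0 : 0 ≤ z) (hz1 : z < 1) :
    |moebiusPowerSeries z| ≤ z / (1 - z) := by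
  have hz : |z| < 1 := by rwa [abs_of_nonneg hz0]
  have h2 : HasSum (fun n : ℕ => (ArithmeticFunction.moebius (n + 1) : ℝ) * z ^ (n + 1))
      (moebiusPowerSeries z) := by
    have := (hasSum_nat_add_iff' 1).mpr (moebiusPowerSeries_hasSum hz)
    simpa using this
  rw [← h2.tsum_eq, div_eq_mul_inv]
  rw [← Real.norm_eq_abs]
  refine tsum_of_norm_bounded ((hasSum_geometric_of_lt_one hz0 hz1).mul_left z) fun n => ?_
  rw [norm_mul, norm_pow, Real.norm_eq_abs, Real.norm_eq_abs, abs_of_nonneg hz0, ← pow_succ']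
  exact mul_le_of_le_one_left (by positivity) (abs_moebius_cast_le_one _)

theorem continuousOn_moebiusPowerSeries :
    ContinuousOn moebiusPowerSeries (Set.Ioo (-1) 1) := by
  intro x hx
  have hx' : |x| < 1 := abs_lt.mpr hx
  obtain ⟨r, hr1, hr2⟩ := exists_between hx'
  have hr0 : 0 ≤ r := (abs_nonneg x).trans hr1.le
  have hc : ContinuousOn moebiusPowerSeries (Set.Ioo (-r) r) := by
    refine continuousOn_tsum (F := ℝ) (u := fun n : ℕ => r ^ n) (fun n => by fun_prop)
      (summable_geometric_of_lt_one hr0 hr2) fun n y hy => ?_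
    rw [norm_mul, norm_pow, Real.norm_eq_abs, Real.norm_eq_abs]
    calc _ ≤ 1 * r ^ n := by
          gcongr
          · exact abs_moebius_cast_le_one n
          · exact (abs_lt.mpr hy).le
      _ = _ := one_mul _
  exact (hc.continuousAt (isOpen_Ioo.mem_nhds (abs_lt.mp hr1))).continuousWithinAt

theorem differentiableAt_mellin_moebiusPowerSeries {a : ℝ}
    (h : moebiusPowerSeries =O[𝓝[<] (1 : ℝ)] fun z : ℝ => (1 - z) ^ (-a)) (ha : 0 ≤ a) {s : ℂ}
    (hs : a < s.re) :
    DifferentiableAt ℂ (mellin fun t : ℝ => (moebiusPowerSeries (Real.exp (-t)) : ℂ)) s := by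
  refine mellin_differentiableAt_of_isBigO_rpow_exp one_pos ?_ ?_ ?_ hs
  · refine ContinuousOn.locallyIntegrableOn ?_ measurableSet_Ioi
    refine Complex.continuous_ofReal.comp_continuousOn
      (continuousOn_moebiusPowerSeries.comp (by fun_prop) fun t ht => ?_)
    exact ⟨by linarith [Real.exp_pos (-t)], by simpa using ht⟩
  · refine IsBigO.of_bound 2 ?_
    filter_upwards [eventually_ge_atTop 1] with t ht
    have h1 : Real.exp (-t) ≤ 1 / 2 := by
      rw [Real.exp_neg, one_div]
      exact inv_anti₀ two_pos (by linarith [Real.add_one_le_exp t])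
    have h0 := Real.exp_pos (-t)
    rw [Complex.norm_real, Real.norm_eq_abs, Real.norm_of_nonneg (Real.exp_pos _).le,
      neg_one_mul]
    refine (abs_moebiusPowerSeries_le_div h0.le (by linarith)).trans ?_
    rw [div_le_iff₀ (by linarith)]
    nlinarith
  · have ht : Tendsto (fun t : ℝ => Real.exp (-t)) (𝓝[>] 0) (𝓝[<] 1) := by
      refine tendsto_nhdsWithin_iff.mpr ⟨?_, ?_⟩
      · have : ContinuousAt (fun t : ℝ => Real.exp (-t)) 0 := by fun_prop
        simpa [ContinuousAt] using this.tendsto.mono_left nhdsWithin_le_nhds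
      · filter_upwards [self_mem_nhdsWithin] with t ht
        simpa using ht
    have h1 : (fun t : ℝ => (moebiusPowerSeries (Real.exp (-t)) : ℂ)) =O[𝓝[>] 0]
        fun t : ℝ => (1 - Real.exp (-t)) ^ (-a) :=
      (Complex.isBigO_ofReal_left).mpr (h.comp_tendsto ht)
    refine h1.trans (IsBigO.of_bound ((1 / 2) ^ (-a)) ?_)
    filter_upwards [Ioo_mem_nhdsGT (zero_lt_one : (0 : ℝ) < 1)] with t ht
    -- The exponent `-a` is nonpositive, so a lower bound for `1 - e^{-t}` linear in `t` is what is
    -- needed.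
    have h2 : 1 / 2 * t ≤ 1 - Real.exp (-t) := by
      have h4 := Real.add_one_le_exp t
      have h3 : Real.exp (-t) ≤ (1 + t)⁻¹ := by
        rw [Real.exp_neg]
        exact inv_anti₀ (by linarith [ht.1]) (by linarith)
      have h5 : (1 + t)⁻¹ ≤ 1 - 1 / 2 * t := by
        rw [inv_le_iff_one_le_mul₀ (by linarith [ht.1])]
        nlinarith [ht.1, ht.2]
      linarith
    have h0 : 0 < 1 / 2 * t := by linarith [ht.1]
    rw [Real.norm_of_nonneg (Real.rpow_nonneg (h0.le.trans h2) _),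
      Real.norm_of_nonneg (Real.rpow_nonneg ht.1.le _), ← Real.mul_rpow (by norm_num) ht.1.le]
    exact Real.rpow_le_rpow_of_nonpos h0 h2 (by linarith)

/-- Termwise, `e^{-nt}` has Mellin transform `Γ(s) n^{-s}`, and absolute convergence for `Re s > 1`
permits the exchange. -/
theorem mellin_moebiusPowerSeries {s : ℂ} (hs : 1 < s.re) :
    riemannZeta s * mellin (fun t : ℝ => (moebiusPowerSeries (Real.exp (-t)) : ℂ)) s =
      Complex.Gamma s := by
  have h := hasSum_mellin (a := fun n : ℕ => (ArithmeticFunction.moebius n : ℂ))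
    (p := fun n : ℕ => (n : ℝ)) (F := fun t : ℝ => (moebiusPowerSeries (Real.exp (-t)) : ℂ))
    (s := s) ?_ (by linarith) ?_ ?_
  · have hL : HasSum (fun n : ℕ => Complex.Gamma s * LSeries.term
        (fun n => (ArithmeticFunction.moebius n : ℂ)) s n)
        (Complex.Gamma s * LSeries (fun n => (ArithmeticFunction.moebius n : ℂ)) s) :=
      ((ArithmeticFunction.LSeriesSummable_moebius_iff.mpr hs).hasSum).mul_left _
    have e : mellin (fun t : ℝ => (moebiusPowerSeries (Real.exp (-t)) : ℂ)) s =
        Complex.Gamma s * LSeries (fun n => (ArithmeticFunction.moebius n : ℂ)) s := by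
      refine h.unique ?_
      convert hL using 2 with n
      rcases eq_or_ne n 0 with rfl | hn
      · simp
      · rw [LSeries.term_of_ne_zero hn, mul_div_assoc, Complex.ofReal_natCast]
    rw [e, mul_left_comm, ← ArithmeticFunction.LSeries_zeta_eq_riemannZeta hs,
      ArithmeticFunction.LSeries_zeta_mul_Lseries_moebius hs, mul_one]
  · intro n
    rcases Nat.eq_zero_or_pos n with rfl | hn
    · simp
    · right; exact_mod_cast hn
  · intro t ht
    have := Complex.hasSum_ofReal.mpr (moebiusPowerSeries_hasSum (z := Real.exp (-t)) (by
      rw [abs_of_pos (Real.exp_pos _)]; simpa using ht))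
    convert this using 2 with n
    push_cast
    rw [← Complex.exp_nat_mul]
    congr 2
    ring
  · refine (Real.summable_nat_rpow_inv.mpr hs).of_nonneg_of_le (fun n => by positivity) fun n => ?_
    rw [inv_eq_one_div]
    gcongr
    have := abs_moebius_cast_le_one n
    rw [← Complex.ofReal_intCast, Complex.norm_real]
    exact this

/-- The identity is continued as `ζ₁ G = (s - 1) Γ`, where `ζ₁ = (s - 1) ζ` is entire, so the pole
at 1 needs no detour. A zero of `ζ` would force a zero of `Γ`. -/
theorem riemannZeta_ne_zero_of_moebiusPowerSeries_isBigO {η : ℝ} (hη : 0 ≤ η) (hη1 : η < 1)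
    (h : ∀ ε : ℝ, 0 < ε →
      moebiusPowerSeries =O[𝓝[<] (1 : ℝ)] fun z : ℝ => (1 - z) ^ (-(η + ε)))
    (s : ℂ) (hs1 : s ≠ 1) (hs : η < s.re) : riemannZeta s ≠ 0 := by
  set G := mellin fun t : ℝ => (moebiusPowerSeries (Real.exp (-t)) : ℂ)
  set U : Set ℂ := {s | η < s.re} with hU
  have hUo : IsOpen U := isOpen_lt continuous_const Complex.continuous_re
  have hG : DifferentiableOn ℂ G U := fun w hw =>
    (differentiableAt_mellin_moebiusPowerSeries (h ((w.re - η) / 2) (by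
      have : η < w.re := hw
      linarith)) (by have : η < w.re := hw; linarith)
      (by have : η < w.re := hw; linarith)).differentiableWithinAt
  have hGam : DifferentiableOn ℂ (fun w => (w - 1) * Complex.Gamma w) U := fun w hw => by
    have hw0 : η < w.re := hw
    refine ((differentiableAt_id.sub_const _).mul
      (Complex.differentiableAt_Gamma w fun m hm => ?_)).differentiableWithinAt
    rw [hm] at hw0
    simp at hw0
    have : (0 : ℝ) ≤ m := by positivity
    linarith
  have key := AnalyticOnNhd.eqOn_of_preconnected_of_eventuallyEq
    ((differentiable_riemannZeta₁.differentiableOn.mul hG).analyticOnNhd hUo)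
    (hGam.analyticOnNhd hUo) (convex_halfSpace_re_gt η).isPreconnected
    (z₀ := 2) (by simp [hU]; linarith) ?_
  · intro hz
    have e := key (show s ∈ U from hs)
    have hz1 : riemannZeta₁ s = 0 := by
      rw [riemannZeta_eq_inv_sub_mul hs1] at hz
      exact (mul_eq_zero.mp hz).resolve_left (inv_ne_zero (sub_ne_zero.mpr hs1))
    simp only [Pi.mul_apply, hz1, zero_mul] at e
    exact mul_ne_zero (sub_ne_zero.mpr hs1)
      (Complex.Gamma_ne_zero_of_re_pos (hη.trans_lt hs)) e.symm
  · have : {w : ℂ | 1 < w.re} ∈ 𝓝 (2 : ℂ) :=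
      (isOpen_lt continuous_const Complex.continuous_re).mem_nhds (by simp)
    filter_upwards [this] with w hw
    have hw1 : w ≠ 1 := by rintro rfl; simp at hw
    have := mellin_moebiusPowerSeries hw
    rw [riemannZeta_eq_inv_sub_mul hw1] at this
    rw [Pi.mul_apply, ← this]
    have := sub_ne_zero.mpr hw1
    field_simp
    rfl

/-! ### Polynomial growth of zeta to the right of the critical line -/

open MeasureTheory in
theorem differentiableAt_integral_fract {s : ℂ} (hs : 0 < s.re) :
    DifferentiableAt ℂ (fun s : ℂ => ∫ t in Set.Ioi (1 : ℝ), ((Int.fract t : ℝ) : ℂ) * (t : ℂ) ^ (-(s + 1))) s := by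
  set h : ℝ → ℂ := (Set.Ioi (1 : ℝ)).indicator fun t => ((Int.fract t : ℝ) : ℂ) with hh
  have hb : ∀ t, ‖h t‖ ≤ 1 := fun t => by
    rw [hh]
    refine (norm_indicator_le_norm_self _ _).trans ?_
    rw [Complex.norm_real, Real.norm_of_nonneg (Int.fract_nonneg t)]
    exact (Int.fract_lt_one t).le
  have hm : Measurable h :=
    (Complex.measurable_ofReal.comp measurable_fract).indicator measurableSet_Ioi
  have e : (fun s : ℂ => ∫ t in Set.Ioi (1 : ℝ), ((Int.fract t : ℝ) : ℂ) * (t : ℂ) ^ (-(s + 1))) =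
      fun s => mellin h (-s) := by
    funext s
    rw [mellin, ← integral_indicator measurableSet_Ioi, ← integral_indicator measurableSet_Ioi]
    congr 1
    funext t
    by_cases ht : t ∈ Set.Ioi (1 : ℝ)
    · have ht0 : t ∈ Set.Ioi (0 : ℝ) := Set.mem_Ioi.mpr (zero_lt_one.trans (Set.mem_Ioi.mp ht))
      rw [Set.indicator_of_mem ht, Set.indicator_of_mem ht0, hh, Set.indicator_of_mem ht,
        smul_eq_mul, mul_comm]
      congr 2
      ring
    · rw [Set.indicator_of_notMem ht, hh]
      by_cases ht0 : t ∈ Set.Ioi (0 : ℝ)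
      · rw [Set.indicator_of_mem ht0, Set.indicator_of_notMem ht, smul_zero]
      · rw [Set.indicator_of_notMem ht0]
  rw [e]
  have hd : DifferentiableAt ℂ (mellin h) (-s) := by
    -- `a = 0` because `h` is bounded; any `b` below `-s.re` serves, since `h` vanishes near 0.
    refine mellin_differentiableAt_of_isBigO_rpow (a := 0) (b := -s.re - 1) ?_ ?_ (by simpa using hs) ?_
      (by simp)
    · refine LocallyIntegrable.locallyIntegrableOn ?_ _
      exact (locallyIntegrable_const (1 : ℝ)).mono hm.aestronglyMeasurable
        (Eventually.of_forall fun t => by simpa using hb t)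
    · refine IsBigO.of_bound 1 (Eventually.of_forall fun t => ?_)
      simpa using hb t
    · refine IsBigO.of_bound 1 ?_
      filter_upwards [Ioo_mem_nhdsGT (zero_lt_one : (0 : ℝ) < 1)] with t ht
      rw [hh, Set.indicator_of_notMem (by simpa using ht.2.le)]
      simp
  exact hd.comp s differentiableAt_id.neg

open MeasureTheory in
theorem norm_integral_fract_le {s : ℂ} (hs : 0 < s.re) :
    ‖∫ t in Set.Ioi (1 : ℝ), ((Int.fract t : ℝ) : ℂ) * (t : ℂ) ^ (-(s + 1))‖ ≤ 1 / s.re := by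
  have hint : IntegrableOn (fun t : ℝ => t ^ (-s.re - 1)) (Set.Ioi 1) :=
    integrableOn_Ioi_rpow_of_lt (by linarith) one_pos
  have hv : ∫ t in Set.Ioi (1 : ℝ), t ^ (-s.re - 1) = 1 / s.re := by
    rw [integral_Ioi_rpow_of_lt (by linarith) one_pos]
    simp [field]
  rw [← hv]
  refine norm_integral_le_of_norm_le hint ?_
  filter_upwards [ae_restrict_mem measurableSet_Ioi] with t ht
  have ht0 : 0 < t := zero_lt_one.trans ht
  rw [norm_mul, Complex.norm_real, Real.norm_of_nonneg (Int.fract_nonneg t),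
    Complex.norm_cpow_eq_rpow_re_of_pos ht0]
  have : (-(s + 1)).re = -s.re - 1 := by simp; ring
  rw [this]
  exact mul_le_of_le_one_left (by positivity) (Int.fract_lt_one t).le

open MeasureTheory in
-- Partial summation gives `ζ(s) = s ∫ ⌊t⌋ t^{-s-1}`; then `⌊t⌋` splits as `t - fract t`.
theorem riemannZeta_eq_sub_integral_fract {s : ℂ} (hs : 1 < s.re) :
    riemannZeta s = s / (s - 1) -
      s * ∫ t in Set.Ioi (1 : ℝ), ((Int.fract t : ℝ) : ℂ) * (t : ℂ) ^ (-(s + 1)) := by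
  have hs1 : s - 1 ≠ 0 := sub_ne_zero.mpr (by rintro rfl; simp at hs)
  have h := LSeries_eq_mul_integral' (1 : ℕ → ℂ) zero_le_one hs (by
    refine IsBigO.of_bound 1 (Eventually.of_forall fun n => ?_)
    simp)
  rw [LSeries_one_eq_riemannZeta hs] at h
  have i1 : IntegrableOn (fun t : ℝ => (t : ℂ) ^ (-s)) (Set.Ioi 1) :=
    integrableOn_Ioi_cpow_of_lt (by simpa using hs) one_pos
  have i2 : IntegrableOn (fun t : ℝ => ((Int.fract t : ℝ) : ℂ) * (t : ℂ) ^ (-(s + 1))) (Set.Ioi 1) := by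
    have i3 : IntegrableOn (fun t : ℝ => (t : ℂ) ^ (-(s + 1))) (Set.Ioi 1) :=
      integrableOn_Ioi_cpow_of_lt (by simp; linarith) one_pos
    refine i3.norm.mono' ((Complex.measurable_ofReal.comp measurable_fract).aestronglyMeasurable.mul
      i3.1) (Eventually.of_forall fun t => ?_)
    rw [norm_mul, Complex.norm_real, Real.norm_of_nonneg (Int.fract_nonneg t)]
    exact mul_le_of_le_one_left (by positivity) (Int.fract_lt_one t).le
  have e : ∫ t in Set.Ioi (1 : ℝ), (∑ k ∈ Finset.Icc 1 ⌊t⌋₊, (1 : ℕ → ℂ) k) * (t : ℂ) ^ (-(s + 1)) =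
      (∫ t in Set.Ioi (1 : ℝ), (t : ℂ) ^ (-s)) -
        ∫ t in Set.Ioi (1 : ℝ), ((Int.fract t : ℝ) : ℂ) * (t : ℂ) ^ (-(s + 1)) := by
    rw [← integral_sub i1 i2]
    refine setIntegral_congr_fun measurableSet_Ioi fun t ht => ?_
    have ht0 : (0 : ℝ) < t := zero_lt_one.trans ht
    have hfl : ((⌊t⌋₊ : ℕ) : ℝ) = t - Int.fract t := by
      rw [natCast_floor_eq_intCast_floor ht0.le]
      exact (Int.self_sub_fract t).symm
    have hfl' : ((⌊t⌋₊ : ℕ) : ℂ) = t - (Int.fract t : ℝ) := by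
      rw [← Complex.ofReal_natCast, hfl, Complex.ofReal_sub]
    have hpow : (t : ℂ) ^ (-s) = t * (t : ℂ) ^ (-(s + 1)) := by
      have : (t : ℂ) ≠ 0 := by exact_mod_cast ht0.ne'
      rw [show -s = 1 + -(s + 1) by ring, Complex.cpow_add _ _ this, Complex.cpow_one]
    simp only [Pi.one_apply, Finset.sum_const, Nat.card_Icc, Nat.add_sub_cancel, nsmul_eq_mul,
      mul_one, hfl', hpow]
    ring
  rw [h, e, integral_Ioi_cpow_of_lt (by simpa using hs) one_pos, Complex.ofReal_one,
    Complex.one_cpow, mul_sub]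
  congr 1
  have : -s + 1 ≠ 0 := by
    contrapose! hs1
    linear_combination -hs1
  field_simp
  ring

theorem riemannZeta₁_eq_sub_integral_fract {s : ℂ} (hs : 0 < s.re) :
    riemannZeta₁ s = s - s * (s - 1) *
      ∫ t in Set.Ioi (1 : ℝ), ((Int.fract t : ℝ) : ℂ) * (t : ℂ) ^ (-(s + 1)) := by
  set U : Set ℂ := {s | 0 < s.re} with hU
  have hUo : IsOpen U := isOpen_lt continuous_const Complex.continuous_re
  have hd : DifferentiableOn ℂ (fun s : ℂ => s - s * (s - 1) *
      ∫ t in Set.Ioi (1 : ℝ), ((Int.fract t : ℝ) : ℂ) * (t : ℂ) ^ (-(s + 1))) U := fun w hw =>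
    (differentiableAt_id.sub (DifferentiableAt.mul (by fun_prop)
      (differentiableAt_integral_fract hw))).differentiableWithinAt
  refine AnalyticOnNhd.eqOn_of_preconnected_of_eventuallyEq
    (differentiable_riemannZeta₁.differentiableOn.analyticOnNhd hUo)
    (hd.analyticOnNhd hUo) (convex_halfSpace_re_gt 0).isPreconnected
    (z₀ := 2) (by simp [hU]) ?_ hs
  have : {w : ℂ | 1 < w.re} ∈ 𝓝 (2 : ℂ) :=
    (isOpen_lt continuous_const Complex.continuous_re).mem_nhds (by simp)
  filter_upwards [this] with w hw
  have hw1 : w ≠ 1 := by rintro rfl; simp at hw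
  have h0 := sub_ne_zero.mpr hw1
  have h := riemannZeta_eq_sub_integral_fract hw
  rw [riemannZeta_eq_inv_sub_mul hw1] at h
  have h2 := congrArg (fun x => (w - 1) * x) h
  simp only [mul_inv_cancel_left₀ h0] at h2
  rw [h2]
  field_simp

theorem norm_riemannZeta₁_le {s : ℂ} (hs : 1 / 2 ≤ s.re) :
    ‖riemannZeta₁ s‖ ≤ ‖s‖ * (1 + 2 * ‖s - 1‖) := by
  have hs0 : 0 < s.re := by linarith
  rw [riemannZeta₁_eq_sub_integral_fract hs0]
  refine (norm_sub_le _ _).trans ?_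
  rw [norm_mul, norm_mul]
  have h1 : 1 / s.re ≤ 2 := by
    rw [div_le_iff₀ hs0]; linarith
  have := (norm_integral_fract_le hs0).trans h1
  calc _ ≤ ‖s‖ + ‖s‖ * ‖s - 1‖ * 2 := by gcongr
    _ = _ := by ring

/-! ### Holomorphic logarithms, Borel–Carathéodory and three circles -/

/-- Take a primitive `f` of `g'/g` on the disc: then `g e^{-f}` has zero derivative. -/
theorem exists_log_of_differentiableOn_ball {g : ℂ → ℂ} {c : ℂ} {R : ℝ} (hR : 0 < R)
    (hg : DifferentiableOn ℂ g (Metric.ball c R)) (h0 : ∀ z ∈ Metric.ball c R, g z ≠ 0) :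
    ∃ f : ℂ → ℂ, DifferentiableOn ℂ f (Metric.ball c R) ∧ f c = Complex.log (g c) ∧
      ∀ z ∈ Metric.ball c R, Complex.exp (f z) = g z := by
  have hc : c ∈ Metric.ball c R := Metric.mem_ball_self hR
  have hq : DifferentiableOn ℂ (fun z => deriv g z / g z) (Metric.ball c R) :=
    (hg.deriv Metric.isOpen_ball).div hg h0
  obtain ⟨f, hfc, hf⟩ := hq.isExactOn_ball.with_val_at c (Complex.log (g c))
  refine ⟨f, fun z hz => (hf z hz).differentiableAt.differentiableWithinAt, hfc, fun z hz => ?_⟩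
  have hd : ∀ z ∈ Metric.ball c R,
      HasDerivAt (fun z => g z * Complex.exp (-f z)) 0 z := fun z hz => by
    have h1 := (hg.differentiableAt (Metric.isOpen_ball.mem_nhds hz)).hasDerivAt
    have h2 := h1.mul ((hf z hz).neg.cexp)
    refine h2.congr_deriv ?_
    have e : deriv g z / g z * g z = deriv g z := div_mul_cancel₀ _ (h0 z hz)
    linear_combination -Complex.exp (-f z) * e
  have hconst := Metric.isOpen_ball.is_const_of_deriv_eq_zero
    (convex_ball c R).isPreconnected
    (fun z hz => (hd z hz).differentiableAt.differentiableWithinAt)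
    (fun z hz => (hd z hz).deriv) hz hc
  rw [hfc, Complex.exp_neg (Complex.log _), Complex.exp_log (h0 c hc), mul_inv_cancel₀ (h0 c hc),
    Complex.exp_neg, mul_inv_eq_one₀ (Complex.exp_ne_zero _)] at hconst
  exact hconst.symm

/-- Borel–Carathéodory, with the centre term absorbed using `1 ≤ M`, so that the factor of `M`
depends only on the radii and `M₀`. -/
theorem norm_le_of_re_le_of_norm_center_le {f : ℂ → ℂ} {c z : ℂ} {r R M M₀ : ℝ} (hr0 : 0 ≤ r)
    (hR : r < R) (hM : 1 ≤ M) (hf : DifferentiableOn ℂ f (Metric.ball c R))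
    (hre : ∀ z ∈ Metric.ball c R, (f z).re ≤ M) (hc : ‖f c‖ ≤ M₀) (hz : ‖z - c‖ ≤ r) :
    ‖f z‖ ≤ (2 * r + M₀ * (R + r)) / (R - r) * M := by
  have hM0 : 0 ≤ M₀ := (norm_nonneg _).trans hc
  have hmaps : Set.MapsTo (fun w : ℂ => c + w) (Metric.ball 0 R) (Metric.ball c R) := fun w hw => by
    simpa [Metric.mem_ball, dist_eq_norm] using hw
  have h := Complex.borelCaratheodory (f := fun w => f (c + w)) (M := M) (R := R) (z := z - c)
    (by linarith) (hf.comp (by fun_prop) hmaps) (fun w hw => hre _ (hmaps hw)) (by linarith)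
    (by simpa [Metric.mem_ball, dist_eq_norm] using hz.trans_lt hR)
  simp only [add_sub_cancel, add_zero] at h
  have hd : 0 < R - r := by linarith
  refine h.trans ?_
  calc 2 * M * ‖z - c‖ / (R - ‖z - c‖) + ‖f c‖ * (R + ‖z - c‖) / (R - ‖z - c‖)
      ≤ 2 * M * r / (R - r) + M₀ * (R + r) / (R - r) := by
        have : 0 ≤ R := by linarith
        gcongr
    _ ≤ 2 * M * r / (R - r) + M₀ * (R + r) / (R - r) * M := by
        gcongr
        exact le_mul_of_one_le_right
          (div_nonneg (mul_nonneg hM0 (by linarith)) hd.le) hM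
    _ = _ := by ring

open Complex.HadamardThreeLines in
/-- **Hadamard three-circle theorem**. -/
theorem norm_le_of_three_circles {f : ℂ → ℂ} {c z : ℂ} {r₁ r₃ R A B : ℝ} (h1 : 0 < r₁)
    (h13 : r₁ < r₃) (h3R : r₃ < R) (hf : DifferentiableOn ℂ f (Metric.ball c R))
    (hA : ∀ z, ‖z - c‖ = r₁ → ‖f z‖ ≤ A) (hB : ∀ z, ‖z - c‖ = r₃ → ‖f z‖ ≤ B)
    (hz1 : r₁ ≤ ‖z - c‖) (hz3 : ‖z - c‖ ≤ r₃) :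
    ‖f z‖ ≤ A ^ (1 - (Real.log ‖z - c‖ - Real.log r₁) / (Real.log r₃ - Real.log r₁)) *
      B ^ ((Real.log ‖z - c‖ - Real.log r₁) / (Real.log r₃ - Real.log r₁)) := by
  have h3 : 0 < r₃ := h1.trans h13
  -- The exponential turns the circles into vertical lines, reducing the claim to the three lines
  -- theorem.
  set e : ℂ → ℂ := fun w => c + Complex.exp w
  have hn : ∀ w, ‖e w - c‖ = Real.exp w.re := fun w => by simp [e, Complex.norm_exp]
  have hball : ∀ w ∈ verticalClosedStrip (Real.log r₁) (Real.log r₃),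
      e w ∈ Metric.closedBall c r₃ := fun w hw => by
    rw [Metric.mem_closedBall, dist_eq_norm, hn, ← Real.le_log_iff_exp_le h3]
    exact hw.2
  have hsub : Metric.closedBall c r₃ ⊆ Metric.ball c R := Metric.closedBall_subset_ball h3R
  have hzc : z - c ≠ 0 := norm_pos_iff.mp (h1.trans_le hz1)
  have hew : e (Complex.log (z - c)) = z := by simp [e, Complex.exp_log hzc]
  have hd : DifferentiableOn ℂ (f ∘ e) (verticalClosedStrip (Real.log r₁) (Real.log r₃)) :=
    hf.comp (by fun_prop) fun w hw => hsub (hball w hw)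
  have hcl : closure (verticalStrip (Real.log r₁) (Real.log r₃)) ⊆
      verticalClosedStrip (Real.log r₁) (Real.log r₃) :=
    closure_minimal (Set.preimage_mono Set.Ioo_subset_Icc_self)
      (isClosed_Icc.preimage Complex.continuous_re)
  have key := norm_le_interp_of_mem_verticalClosedStrip' (f := f ∘ e) (z := Complex.log (z - c))
    (a := A) (b := B) (Real.log_lt_log h1 h13)
    (by
      simp only [verticalClosedStrip, Set.mem_preimage, Complex.log_re]
      exact ⟨Real.log_le_log h1 hz1, Real.log_le_log (h1.trans_le hz1) hz3⟩)
    (hd.mono hcl).diffContOnCl ?_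
    (fun w hw => hA _ (by
      rw [hn, show w.re = _ from hw, Real.exp_log h1]))
    (fun w hw => hB _ (by
      rw [hn, show w.re = _ from hw, Real.exp_log h3]))
  · simpa only [Function.comp_apply, hew, Complex.log_re] using key
  · obtain ⟨C, hC⟩ := (isCompact_closedBall c r₃).exists_bound_of_continuousOn
      (hf.continuousOn.mono hsub)
    refine ⟨C, ?_⟩
    rintro _ ⟨w, hw, rfl⟩
    exact hC _ (hball w hw)

/-- A zero-free holomorphic function on a disc that is bounded near the centre has a reciprocal
of subpolynomial size on smaller discs. -/
theorem exists_norm_inv_le_exp_mul_rpow {r₁ r₂ r₃ R M₀ : ℝ} (h1 : 0 < r₁) (h12 : r₁ < r₂)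
    (h23 : r₂ < r₃) (h3R : r₃ < R) (h1R : 2 * r₁ ≤ R) (hM0 : 1 ≤ M₀) :
    ∃ D θ : ℝ, 0 ≤ D ∧ 0 < θ ∧ θ < 1 ∧ ∀ (φ : ℂ → ℂ) (c : ℂ) (M : ℝ), 1 ≤ M →
      DifferentiableOn ℂ φ (Metric.ball c R) →
      (∀ z ∈ Metric.ball c R, φ z ≠ 0) →
      (∀ z ∈ Metric.ball c R, ‖φ z‖ ≤ Real.exp M) →
      (∀ z ∈ Metric.ball c (2 * r₁), ‖φ z‖ ≤ Real.exp M₀) →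
      ‖Complex.log (φ c)‖ ≤ M₀ →
      ∀ z, ‖z - c‖ ≤ r₂ → ‖(φ z)⁻¹‖ ≤ Real.exp (D * M ^ θ) := by
  -- `A` bounds the logarithm on radius `r₁` and `B * M` on radius `r₃`. With one `D ≥ A, B`,
  -- interpolation gives `D^(1-τ) (D M)^τ = D M^τ`.
  set A := (2 * r₁ + M₀ * (2 * r₁ + r₁)) / (2 * r₁ - r₁) * M₀
  set B := (2 * r₃ + M₀ * (R + r₃)) / (R - r₃)
  set D := max 1 (max A B)
  have hD1 : 1 ≤ D := le_max_left _ _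
  have hAD : A ≤ D := (le_max_left _ _).trans (le_max_right _ _)
  have hBD : B ≤ D := (le_max_right _ _).trans (le_max_right _ _)
  have h2 : 0 < r₂ := h1.trans h12
  have h3 : 0 < r₃ := h2.trans h23
  have l12 := Real.log_lt_log h1 h12
  have l23 := Real.log_lt_log h2 h23
  have hL : 0 < Real.log r₃ - Real.log r₁ := by linarith
  refine ⟨D, (Real.log r₂ - Real.log r₁) / (Real.log r₃ - Real.log r₁), by linarith,
    div_pos (by linarith) hL, (div_lt_one hL).mpr (by linarith), ?_⟩
  intro φ c M hM hφ hφ0 hφM hφM0 hc z hz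
  set θ := (Real.log r₂ - Real.log r₁) / (Real.log r₃ - Real.log r₁)
  obtain ⟨f, hf, hfc, hfe⟩ := exists_log_of_differentiableOn_ball (by linarith) hφ hφ0
  have hsub : Metric.ball c (2 * r₁) ⊆ Metric.ball c R := Metric.ball_subset_ball h1R
  have hre : ∀ z ∈ Metric.ball c R, ∀ {m : ℝ}, ‖φ z‖ ≤ Real.exp m → (f z).re ≤ m := by
    intro z hz m hm
    rwa [← hfe z hz, Complex.norm_exp, Real.exp_le_exp] at hm
  have small : ∀ z, ‖z - c‖ ≤ r₁ → ‖f z‖ ≤ A := fun z hz =>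
    norm_le_of_re_le_of_norm_center_le h1.le (by linarith) hM0 (hf.mono hsub)
      (fun z hz => hre z (hsub hz) (hφM0 z hz)) (hfc ▸ hc) hz
  have large : ∀ z, ‖z - c‖ ≤ r₃ → ‖f z‖ ≤ B * M := fun z hz =>
    norm_le_of_re_le_of_norm_center_le h3.le h3R hM hf
      (fun z hz => hre z hz (hφM z hz)) (hfc ▸ hc) hz
  have hθ : 0 < θ := div_pos (by linarith) hL
  have key : ‖f z‖ ≤ D * M ^ θ := by
    rcases le_total ‖z - c‖ r₁ with hz1 | hz1
    · calc ‖f z‖ ≤ D * 1 := by rw [mul_one]; exact (small z hz1).trans hAD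
        _ ≤ D * M ^ θ := by
          gcongr
          exact Real.one_le_rpow hM hθ.le
    · have h := norm_le_of_three_circles h1 (h12.trans h23) h3R hf
        (fun z hz => (small z hz.le).trans hAD)
        (fun z hz => (large z hz.le).trans (mul_le_mul_of_nonneg_right hBD (by linarith)))
        hz1 (hz.trans h23.le)
      set τ := (Real.log ‖z - c‖ - Real.log r₁) / (Real.log r₃ - Real.log r₁)
      have hτ : τ ≤ θ := by
        have := Real.log_le_log (h1.trans_le hz1) hz
        simp only [τ, θ]
        gcongr
      have hD0 : 0 < D := by linarith
      calc ‖f z‖ ≤ D ^ (1 - τ) * (D * M) ^ τ := h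
        _ = D * M ^ τ := by
          rw [Real.mul_rpow hD0.le (by linarith), ← mul_assoc, ← Real.rpow_add hD0,
            sub_add_cancel, Real.rpow_one]
        _ ≤ D * M ^ θ := by gcongr
  have hzR : z ∈ Metric.ball c R := by
    rw [Metric.mem_ball, dist_eq_norm]; linarith
  rw [← hfe z hzR, ← Complex.exp_neg, Complex.norm_exp, Real.exp_le_exp, Complex.neg_re]
  exact (neg_le_abs _).trans ((Complex.abs_re_le_norm _).trans key)

/-! ### Subpolynomial growth of the reciprocal of zeta -/

/-- At `x = log T` this turns `exp (D (log T)^θ)` into `O(T^ε)`. -/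
theorem exists_mul_rpow_le_mul_add (D : ℝ) {θ ε : ℝ} (hD : 0 ≤ D) (hθ : 0 < θ) (hθ1 : θ < 1)
    (hε : 0 < ε) : ∃ K : ℝ, ∀ x : ℝ, 1 ≤ x → D * x ^ θ ≤ ε * x + K := by
  have h : Tendsto (fun x : ℝ => D * x ^ (-(1 - θ))) atTop (𝓝 0) := by
    simpa using (tendsto_rpow_neg_atTop (by linarith : 0 < 1 - θ)).const_mul D
  obtain ⟨X, hX⟩ := eventually_atTop.mp (h.eventually_le_const hε)
  refine ⟨D * (max X 1) ^ θ, fun x hx => ?_⟩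
  have hx0 : 0 < x := by linarith
  have hK : 0 ≤ D * (max X 1) ^ θ := mul_nonneg hD (Real.rpow_nonneg (by positivity) _)
  rcases le_total X x with hXx | hXx
  · have e : D * x ^ θ = D * x ^ (-(1 - θ)) * x := by
      rw [mul_assoc, ← Real.rpow_add_one hx0.ne']
      congr 2
      ring
    rw [e]
    have := mul_le_mul_of_nonneg_right (hX x hXx) hx0.le
    linarith
  · have : x ^ θ ≤ (max X 1) ^ θ :=
      Real.rpow_le_rpow hx0.le (hXx.trans (le_max_left _ _)) hθ.le
    have := mul_le_mul_of_nonneg_left this hD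
    have : 0 ≤ ε * x := by positivity
    linarith

theorem exists_norm_riemannZeta_le {σ : ℝ} (hσ : 1 < σ) :
    ∃ K : ℝ, 1 ≤ K ∧ ∀ s : ℂ, σ ≤ s.re →
      ‖riemannZeta s‖ ≤ K ∧ ‖(riemannZeta s)⁻¹‖ ≤ K := by
  have hsum : Summable fun n : ℕ => 1 / (n : ℝ) ^ σ := Real.summable_one_div_nat_rpow.mpr hσ
  set K := ∑' n : ℕ, 1 / (n : ℝ) ^ σ
  have hL : ∀ (a : ℕ → ℂ) (s : ℂ), (∀ n, ‖a n‖ ≤ 1) → σ ≤ s.re → ‖LSeries a s‖ ≤ K := by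
    intro a s ha hs
    refine tsum_of_norm_bounded hsum.hasSum fun n => ?_
    rw [LSeries.norm_term_eq]
    split_ifs with hn
    · positivity
    · have hn1 : (1 : ℝ) ≤ n := by exact_mod_cast Nat.one_le_iff_ne_zero.mpr hn
      have h0 : (0 : ℝ) < n := by linarith
      gcongr
      · exact ha n
  refine ⟨max K 1, le_max_right _ _, fun s hs => ?_⟩
  have hs1 : 1 < s.re := hσ.trans_le hs
  have hinv : (riemannZeta s)⁻¹ = LSeries (fun n => (ArithmeticFunction.moebius n : ℂ)) s := by
    rw [← ArithmeticFunction.LSeries_zeta_eq_riemannZeta hs1]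
    exact inv_eq_of_mul_eq_one_right (ArithmeticFunction.LSeries_zeta_mul_Lseries_moebius hs1)
  constructor
  · rw [← LSeries_one_eq_riemannZeta hs1]
    exact (hL _ s (fun n => by simp) hs).trans (le_max_left _ _)
  · rw [hinv]
    refine (hL _ s (fun n => ?_) hs).trans (le_max_left _ _)
    rw [← Complex.ofReal_intCast, Complex.norm_real]
    exact abs_moebius_cast_le_one n

theorem norm_sub_one_le_norm_add_one {s : ℂ} (hs : 0 ≤ s.re) : ‖s - 1‖ ≤ ‖s + 1‖ := by
  rw [← sq_le_sq₀ (norm_nonneg _) (norm_nonneg _), Complex.sq_norm, Complex.sq_norm,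
    Complex.normSq_apply, Complex.normSq_apply]
  simp
  nlinarith

theorem norm_le_norm_add_one {s : ℂ} (hs : 0 ≤ s.re) : ‖s‖ ≤ ‖s + 1‖ := by
  rw [← sq_le_sq₀ (norm_nonneg _) (norm_nonneg _), Complex.sq_norm, Complex.sq_norm,
    Complex.normSq_apply, Complex.normSq_apply]
  simp
  nlinarith

theorem riemannZeta₁_ne_zero_of_riemannZeta_ne_zero {s : ℂ} (h : s ≠ 1 → riemannZeta s ≠ 0) :
    riemannZeta₁ s ≠ 0 := by
  rcases eq_or_ne s 1 with rfl | hs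
  · simp
  · have := h hs
    rw [riemannZeta_eq_inv_sub_mul hs] at this
    exact right_ne_zero_of_mul this

/-- Under the zero-free hypothesis, `1 / ζ` grows subpolynomially on vertical lines. -/
theorem exists_norm_sub_one_div_riemannZeta₁_le {η σ ε : ℝ} (hη : 1 / 2 ≤ η) (hσ : η < σ)
    (hσ1 : σ < 1) (hζ : ∀ s : ℂ, s ≠ 1 → η < s.re → riemannZeta s ≠ 0) (hε : 0 < ε) :
    ∃ C : ℝ, 0 ≤ C ∧ ∀ s : ℂ, σ ≤ s.re → s.re ≤ 2 →
      ‖(s - 1) / riemannZeta₁ s‖ ≤ C * (1 + |s.im|) ^ ε := by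
  obtain ⟨K, hK1, hK⟩ := exists_norm_riemannZeta_le (by norm_num : (1 : ℝ) < 3 / 2)
  have hπ := Real.pi_gt_three
  -- `log (3K)` controls `|log ‖φ c‖|`, and `π` the argument, in the principal logarithm at the
  -- centre.
  set M₀ := Real.log (3 * K) + Real.pi
  have hlogK : 0 ≤ Real.log (3 * K) := Real.log_nonneg (by linarith)
  -- For discs centred on `Re = 2`: `R` reaches the line `Re = η`, `r₂` reaches `Re = σ`, `r₃` lies
  -- midway, and `2 r₁ = 1/2` stays in `Re > 3/2`, where `ζ` and `1/ζ` are bounded.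
  obtain ⟨D, θ, hD, hθ, hθ1, main⟩ := exists_norm_inv_le_exp_mul_rpow (r₁ := 1 / 4) (r₂ := 2 - σ)
    (r₃ := 2 - (σ + η) / 2) (R := 2 - η) (M₀ := M₀) (by norm_num) (by linarith) (by linarith)
    (by linarith) (by linarith) (by linarith)
  obtain ⟨K', hK'⟩ := exists_mul_rpow_le_mul_add D hD hθ hθ1 hε
  refine ⟨Real.exp K' * 8 ^ ε, by positivity, fun s hs hs2 => ?_⟩
  -- The disc may contain `s = 1`. Dividing `ζ₁` by `s + 1` instead of `s - 1` avoids the pole and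
  -- keeps the size of `ζ` away from it.
  set φ : ℂ → ℂ := fun s => riemannZeta₁ s / (s + 1) with hφ
  set c : ℂ := ⟨2, s.im⟩ with hc
  have hball : ∀ {r : ℝ} {z : ℂ}, z ∈ Metric.ball c r → 2 - r < z.re := by
    intro r z hz
    rw [Metric.mem_ball, dist_eq_norm] at hz
    have h2 := (abs_lt.mp ((Complex.abs_re_le_norm (z - c)).trans_lt hz)).1
    simp [hc] at h2
    linarith
  have hadd : ∀ {z : ℂ}, 0 < z.re → z + 1 ≠ 0 := fun {z} hz h => by
    have := congrArg Complex.re h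
    simp at this
    linarith
  have hφζ : ∀ {z : ℂ}, 3 / 2 ≤ z.re → φ z = riemannZeta z * ((z - 1) / (z + 1)) := fun {z} hz => by
    have h1 : z ≠ 1 := by rintro rfl; norm_num at hz
    have := sub_ne_zero.mpr h1
    rw [hφ, riemannZeta_eq_inv_sub_mul h1]
    field_simp
  have hM1 : 1 ≤ Real.log (8 + 2 * |s.im|) := by
    rw [Real.le_log_iff_exp_le (by positivity)]
    have := Real.exp_one_lt_d9
    linarith [abs_nonneg s.im]
  have hpos : 0 < 8 + 2 * |s.im| := by positivity
  have hb := main φ c (Real.log (8 + 2 * |s.im|)) hM1 ?_ ?_ ?_ ?_ ?_ s ?_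
  · have hs0 : 0 ≤ s.re := by linarith
    have hs1 := hadd (show 0 < s.re by linarith)
    have e : (s - 1) / riemannZeta₁ s = (s - 1) / (s + 1) * (φ s)⁻¹ := by
      rw [hφ]
      simp only [inv_div]
      field_simp
    rw [e, norm_mul]
    have h1 : ‖(s - 1) / (s + 1)‖ ≤ 1 := by
      rw [norm_div]
      exact div_le_one_of_le₀ (norm_sub_one_le_norm_add_one hs0) (norm_nonneg _)
    calc ‖(s - 1) / (s + 1)‖ * ‖(φ s)⁻¹‖
        ≤ 1 * Real.exp (D * Real.log (8 + 2 * |s.im|) ^ θ) := by gcongr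
      _ ≤ 1 * Real.exp (ε * Real.log (8 + 2 * |s.im|) + K') := by
        gcongr
        exact hK' _ hM1
      _ = Real.exp K' * (8 + 2 * |s.im|) ^ ε := by
        rw [one_mul, Real.exp_add, Real.rpow_def_of_pos hpos, mul_comm (Real.log _), mul_comm]
      _ ≤ Real.exp K' * (8 * (1 + |s.im|)) ^ ε := by
        gcongr
        linarith [abs_nonneg s.im]
      _ = _ := by rw [Real.mul_rpow (by norm_num) (by positivity), mul_assoc]
  · intro z hz
    have := hball hz
    exact (differentiable_riemannZeta₁.differentiableAt.div (differentiableAt_id.add_const 1)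
      (hadd (show 0 < z.re by linarith))).differentiableWithinAt
  · intro z hz
    have := hball hz
    exact div_ne_zero (riemannZeta₁_ne_zero_of_riemannZeta_ne_zero fun h => hζ z h (by linarith))
      (hadd (by linarith))
  · intro z hz
    have hzre := hball hz
    have hz0 : 0 ≤ z.re := by linarith
    rw [Real.exp_log hpos, hφ, norm_div,
      div_le_iff₀ (norm_pos_iff.mpr (hadd (show 0 < z.re by linarith)))]
    refine (norm_riemannZeta₁_le (by linarith)).trans ?_
    rw [mul_comm]
    have hz1 : ‖z - 1‖ ≤ 3 / 2 + (1 + |s.im|) := by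
      rw [Metric.mem_ball, dist_eq_norm] at hz
      have h1 : ‖c - 1‖ ≤ 1 + |s.im| := by
        refine (Complex.norm_le_abs_re_add_abs_im _).trans ?_
        simp [hc]
        norm_num
      calc ‖z - 1‖ = ‖(z - c) + (c - 1)‖ := by congr 1; ring
        _ ≤ ‖z - c‖ + ‖c - 1‖ := norm_add_le _ _
        _ ≤ _ := by linarith
    exact mul_le_mul (by linarith) (norm_le_norm_add_one hz0) (norm_nonneg _) hpos.le
  · intro z hz
    have hzre := hball hz
    have hz0 : 3 / 2 ≤ z.re := by linarith
    rw [hφζ hz0, norm_mul, norm_div]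
    calc ‖riemannZeta z‖ * (‖z - 1‖ / ‖z + 1‖) ≤ K * 1 := by
          gcongr
          · exact (hK z hz0).1
          · exact div_le_one_of_le₀ (norm_sub_one_le_norm_add_one (by linarith)) (norm_nonneg _)
      _ ≤ 3 * K := by linarith
      _ = Real.exp (Real.log (3 * K)) := (Real.exp_log (by linarith)).symm
      _ ≤ Real.exp M₀ := by gcongr; linarith
  · have hc0 : 3 / 2 ≤ c.re := by norm_num [hc]
    have hφc := hφζ hc0
    have hup : ‖φ c‖ ≤ 3 * K := by
      rw [hφc, norm_mul, norm_div]
      calc ‖riemannZeta c‖ * (‖c - 1‖ / ‖c + 1‖) ≤ K * 1 := by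
            gcongr
            · exact (hK c hc0).1
            · exact div_le_one_of_le₀ (norm_sub_one_le_norm_add_one (by linarith)) (norm_nonneg _)
        _ ≤ 3 * K := by linarith
    have hlow : ‖(φ c)⁻¹‖ ≤ 3 * K := by
      have h1 : 1 ≤ ‖c - 1‖ := by
        refine le_trans ?_ (Complex.abs_re_le_norm _)
        simp [hc]
        norm_num
      have h2 : ‖c + 1‖ ≤ 3 * ‖c - 1‖ := by
        calc ‖c + 1‖ = ‖(c - 1) + 2‖ := by congr 1; ring
          _ ≤ ‖c - 1‖ + ‖(2 : ℂ)‖ := norm_add_le _ _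
          _ ≤ _ := by norm_num; linarith
      rw [hφc, mul_inv, inv_div, norm_mul, norm_div, mul_comm]
      have h3 := (hK c hc0).2
      gcongr
      exact (div_le_iff₀ (by linarith)).mpr h2
    have hφ0 : 0 < ‖φ c‖ := by
      refine norm_pos_iff.mpr (div_ne_zero (riemannZeta₁_ne_zero_of_riemannZeta_ne_zero
        fun h => hζ c h (by linarith)) (hadd (by linarith)))
    refine (Complex.norm_le_abs_re_add_abs_im _).trans ?_
    rw [Complex.log_re, Complex.log_im]
    refine add_le_add (abs_le.mpr ⟨?_, Real.log_le_log hφ0 hup⟩) (Complex.abs_arg_le_pi _)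
    rw [neg_le, ← Real.log_inv, ← norm_inv]
    exact Real.log_le_log (by rw [norm_inv]; exact inv_pos.mpr hφ0) hlow
  · have e : s - c = ((s.re - 2 : ℝ) : ℂ) := by
      apply Complex.ext <;> simp [hc]
    rw [e, Complex.norm_real, Real.norm_eq_abs, abs_of_nonpos (by linarith)]
    linarith

/-! ### Contour shift and Mellin inversion -/

theorem integrable_of_norm_le_one_add_abs_rpow {f : ℝ → ℂ} (hf : Continuous f) {C κ : ℝ}
    (hκ : 0 < κ) (hb : ∀ y, ‖f y‖ ≤ C * (1 + |y|) ^ (-(1 + κ))) : MeasureTheory.Integrable f := by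
  have h : MeasureTheory.Integrable fun y : ℝ => C * (1 + ‖y‖) ^ (-(1 + κ)) :=
    (integrable_one_add_norm (by simpa using hκ)).const_mul C
  exact h.mono' hf.aestronglyMeasurable (Eventually.of_forall fun y => by simpa using hb y)

/-- Shifting a vertical line of integration across a strip of holomorphy. -/
theorem integral_vertical_line_eq {F : ℂ → ℂ} {a b C κ : ℝ} (hab : a ≤ b) (hκ : 0 < κ)
    (hF : DifferentiableOn ℂ F {s | a ≤ s.re ∧ s.re ≤ b})
    (hb : ∀ s : ℂ, a ≤ s.re → s.re ≤ b → ‖F s‖ ≤ C * (1 + |s.im|) ^ (-(1 + κ))) :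
    ∫ y : ℝ, F (a + y * Complex.I) = ∫ y : ℝ, F (b + y * Complex.I) := by
  have hint : ∀ c, a ≤ c → c ≤ b →
      MeasureTheory.Integrable fun y : ℝ => F (c + y * Complex.I) := fun c hac hcb => by
    refine integrable_of_norm_le_one_add_abs_rpow (C := C) ?_ hκ fun y => ?_
    · exact hF.continuousOn.comp_continuous (by fun_prop) fun y => by simp [hac, hcb]
    · simpa using hb (c + y * Complex.I) (by simpa using hac) (by simpa using hcb)
  have hlim : ∀ c, a ≤ c → c ≤ b → Tendsto (fun T : ℝ => ∫ y in (-T)..T, F (c + y * Complex.I))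
      atTop (𝓝 (∫ y : ℝ, F (c + y * Complex.I))) := fun c hac hcb =>
    MeasureTheory.intervalIntegral_tendsto_integral (hint c hac hcb) tendsto_neg_atTop_atBot
      tendsto_id
  have hside : ∀ T : ℝ, ‖∫ x in a..b, F (x + T * Complex.I)‖ ≤
      C * (1 + |T|) ^ (-(1 + κ)) * |b - a| := fun T => by
    refine intervalIntegral.norm_integral_le_of_norm_le_const fun x hx => ?_
    rw [Set.uIoc_of_le hab] at hx
    simpa using hb (x + T * Complex.I) (by simpa using hx.1.le) (by simpa using hx.2)
  have hdiff : Tendsto (fun T : ℝ => (∫ y in (-T)..T, F (b + y * Complex.I)) -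
      ∫ y in (-T)..T, F (a + y * Complex.I)) atTop (𝓝 0) := by
    -- By Cauchy on a rectangle of half-height `T`, the difference is carried by the two horizontal
    -- sides, which tend to 0.
    have h0 : Tendsto (fun T : ℝ => 2 * (C * (1 + T) ^ (-(1 + κ)) * |b - a|)) atTop (𝓝 0) := by
      have := (tendsto_rpow_neg_atTop (by linarith : 0 < 1 + κ)).comp
        (tendsto_atTop_add_const_left atTop (1 : ℝ) tendsto_id)
      simpa using ((this.const_mul C).mul_const |b - a|).const_mul 2
    refine squeeze_zero_norm' ?_ h0
    filter_upwards [eventually_ge_atTop 0] with T hT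
    have hrect := Complex.integral_boundary_rect_eq_zero_of_differentiableOn F
      (⟨a, -T⟩ : ℂ) (⟨b, T⟩ : ℂ) (hF.mono fun s hs => by
        rw [Complex.mem_reProdIm, Set.uIcc_of_le hab] at hs
        exact hs.1)
    simp only [smul_eq_mul, Complex.ofReal_neg] at hrect
    have h1 := hside T
    have h2 := hside (-T)
    rw [abs_of_nonneg hT] at h1
    rw [abs_neg, abs_of_nonneg hT, Complex.ofReal_neg] at h2
    have e : Complex.I * ((∫ y in (-T)..T, F (b + y * Complex.I)) -
        ∫ y in (-T)..T, F (a + y * Complex.I)) =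
        (∫ x in a..b, F (x + T * Complex.I)) - ∫ x in a..b, F (x + -T * Complex.I) := by
      linear_combination hrect
    rw [← one_mul ‖(_ - _ : ℂ)‖, show (1 : ℝ) = ‖Complex.I‖ from Complex.norm_I.symm, ← norm_mul, e,
      Complex.norm_I]
    refine (norm_sub_le _ _).trans ?_
    linarith
  have h3 := (hlim b hab le_rfl).sub (hlim a le_rfl hab)
  exact (sub_eq_zero.mp (tendsto_nhds_unique h3 hdiff)).symm

theorem one_add_sq_le_norm_mul_norm (y : ℝ) :
    1 + y ^ 2 ≤ ‖(2 : ℂ) + y * Complex.I‖ * ‖(2 : ℂ) + y * Complex.I + 1‖ := by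
  have h : ∀ c : ℝ, 1 ≤ c → 1 + y ^ 2 ≤ ‖(c : ℂ) + y * Complex.I‖ ^ 2 := fun c hc => by
    rw [Complex.sq_norm, Complex.normSq_add_mul_I]
    nlinarith
  have h2 := h 2 (by norm_num)
  have h23 : ‖(2 : ℂ) + y * Complex.I‖ ≤ ‖(2 : ℂ) + y * Complex.I + 1‖ :=
    norm_le_norm_add_one (by simp)
  push_cast at h2
  calc _ ≤ ‖(2 : ℂ) + y * Complex.I‖ ^ 2 := h2
    _ = ‖(2 : ℂ) + y * Complex.I‖ * ‖(2 : ℂ) + y * Complex.I‖ := sq _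
    _ ≤ _ := by gcongr

theorem norm_inv_mul_add_one_le (y : ℝ) :
    ‖(((2 : ℂ) + y * Complex.I) * ((2 : ℂ) + y * Complex.I + 1))⁻¹‖ ≤ (1 + y ^ 2)⁻¹ := by
  rw [norm_inv, norm_mul]
  exact inv_anti₀ (by positivity) (one_add_sq_le_norm_mul_norm y)

theorem two_add_mul_I_ne_zero (y : ℝ) : (2 : ℂ) + y * Complex.I ≠ 0 := fun h => by
  have := congrArg Complex.re h
  simp at this

theorem two_add_mul_I_add_one_ne_zero (y : ℝ) : (2 : ℂ) + y * Complex.I + 1 ≠ 0 := fun h => by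
  have := congrArg Complex.re h
  norm_num at this

theorem integrable_inv_mul_add_one : MeasureTheory.Integrable fun y : ℝ =>
    (((2 : ℂ) + y * Complex.I) * ((2 : ℂ) + y * Complex.I + 1))⁻¹ := by
  refine integrable_inv_one_add_sq.mono' (Continuous.aestronglyMeasurable ?_)
    (Eventually.of_forall norm_inv_mul_add_one_le)
  exact Continuous.inv₀ (by fun_prop) fun y =>
    mul_ne_zero (two_add_mul_I_ne_zero y) (two_add_mul_I_add_one_ne_zero y)

/-- The Mellin inversion formula for `max 0 (1 - x)`. -/
theorem integral_cpow_neg_mul_inv_mul_add_one {x : ℝ} (hx : 0 < x) :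
    ∫ y : ℝ, (x : ℂ) ^ (-((2 : ℂ) + y * Complex.I)) *
      (((2 : ℂ) + y * Complex.I) * ((2 : ℂ) + y * Complex.I + 1))⁻¹ =
      2 * Real.pi * (max 0 (1 - x) : ℝ) := by
  -- The Mellin transform of this form is read off as `1/s - 1/(s + 1) = 1/(s (s + 1))`.
  set f : ℝ → ℂ := fun t => (Set.Ioc (0 : ℝ) 1).indicator (fun _ => (1 : ℂ)) t -
    (Set.Ioc (0 : ℝ) 1).indicator (fun t : ℝ => (t : ℂ) ^ (1 : ℂ)) t with hf
  have hmel : ∀ s : ℂ, 0 < s.re → HasMellin f s ((s * (s + 1))⁻¹) := fun s hs => by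
    have h1 := hasMellin_one_Ioc hs
    have h2 := hasMellin_cpow_Ioc 1 (s := s) (by simp; linarith)
    have h := hasMellin_sub h1.1 h2.1
    refine ⟨h.1, h.2.trans ?_⟩
    rw [h1.2, h2.2]
    have e1 : s ≠ 0 := by rintro rfl; simp at hs
    have e2 : s + 1 ≠ 0 := fun h => by
      have := congrArg Complex.re h
      simp at this
      linarith
    field_simp
    ring
  have hval : ∀ t : ℝ, 0 < t → f t = (max 0 (1 - t) : ℝ) := fun t ht => by
    rw [hf]
    by_cases h : t ≤ 1
    · have hm : t ∈ Set.Ioc (0 : ℝ) 1 := ⟨ht, h⟩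
      simp [Set.indicator_of_mem hm, max_eq_right (sub_nonneg.mpr h)]
    · have hm : t ∉ Set.Ioc (0 : ℝ) 1 := fun hm => h hm.2
      simp [Set.indicator_of_notMem hm, max_eq_left (sub_nonpos.mpr (not_le.mp h).le)]
  have hcont : ContinuousAt f x := by
    have : ContinuousAt (fun t : ℝ => ((max 0 (1 - t) : ℝ) : ℂ)) x := by fun_prop
    refine this.congr ?_
    filter_upwards [lt_mem_nhds hx] with t ht
    exact (hval t ht).symm
  have hline : ∀ y : ℝ, mellin f (((2 : ℝ) : ℂ) + y * Complex.I) =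
      (((2 : ℂ) + y * Complex.I) * ((2 : ℂ) + y * Complex.I + 1))⁻¹ := fun y => by
    rw [(hmel _ (by simp)).2]
    push_cast
    rfl
  have hinv := mellinInv_mellin_eq 2 f hx (hmel _ (by simp)).1 (by
    rw [Complex.VerticalIntegrable]
    simp_rw [hline]
    exact integrable_inv_mul_add_one) hcont
  rw [mellinInv, hval x hx] at hinv
  simp_rw [hline] at hinv
  have hπ : (Real.pi : ℂ) ≠ 0 := by exact_mod_cast Real.pi_ne_zero
  simp only [Complex.ofReal_ofNat, smul_eq_mul, Complex.real_smul] at hinv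
  rw [← hinv]
  generalize (∫ y : ℝ, (x : ℂ) ^ (-((2 : ℂ) + y * Complex.I)) *
      (((2 : ℂ) + y * Complex.I) * ((2 : ℂ) + y * Complex.I + 1))⁻¹) = J
  push_cast
  field_simp

theorem sub_one_div_riemannZeta₁_eq {s : ℂ} (hs : 1 < s.re) :
    (s - 1) / riemannZeta₁ s = LSeries (fun n => (ArithmeticFunction.moebius n : ℂ)) s := by
  have hs1 : s ≠ 1 := by rintro rfl; simp at hs
  rw [← inv_eq_of_mul_eq_one_right (ArithmeticFunction.LSeries_zeta_mul_Lseries_moebius hs),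
    ArithmeticFunction.LSeries_zeta_eq_riemannZeta hs, riemannZeta_eq_inv_sub_mul hs1, mul_inv,
    inv_inv, div_eq_mul_inv]

open MeasureTheory in
-- Expand `1/ζ` in its Dirichlet series on `Re s = 2`, where everything converges absolutely, and
-- invert each term at `x = n/N`; the weight `max 0 (1 - n/N)` cuts the sum at `N`.
theorem integral_cpow_mul_sub_one_div_riemannZeta₁ {N : ℕ} (hN : 0 < N) :
    ∫ y : ℝ, (N : ℂ) ^ ((2 : ℂ) + y * Complex.I) *
      (((2 : ℂ) + y * Complex.I) * ((2 : ℂ) + y * Complex.I + 1))⁻¹ *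
      (((2 : ℂ) + y * Complex.I - 1) / riemannZeta₁ ((2 : ℂ) + y * Complex.I)) =
      2 * Real.pi * ((∑ n ∈ Finset.Icc 1 N, (ArithmeticFunction.moebius n : ℝ) * (1 - n / N) : ℝ) : ℂ) := by
  have hN0 : (0 : ℝ) < N := by exact_mod_cast hN
  set F : ℕ → ℝ → ℂ := fun n y => (ArithmeticFunction.moebius n : ℂ) *
    ((((n : ℝ) / N : ℝ) : ℂ) ^ (-((2 : ℂ) + y * Complex.I)) *
      (((2 : ℂ) + y * Complex.I) * ((2 : ℂ) + y * Complex.I + 1))⁻¹) with hFdef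
  have hnorm : ∀ n y, ‖F n y‖ ≤ (N : ℝ) ^ 2 * (1 / (n : ℝ) ^ 2) *
      ‖(((2 : ℂ) + y * Complex.I) * ((2 : ℂ) + y * Complex.I + 1))⁻¹‖ := fun n y => by
    rcases Nat.eq_zero_or_pos n with rfl | hn
    · simp [hFdef]
    · have hn0 : (0 : ℝ) < n := by exact_mod_cast hn
      rw [hFdef, norm_mul, norm_mul, ← mul_assoc]
      refine mul_le_mul_of_nonneg_right ?_ (norm_nonneg _)
      have h1 : ‖(ArithmeticFunction.moebius n : ℂ)‖ ≤ 1 := by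
        rw [← Complex.ofReal_intCast, Complex.norm_real]
        exact abs_moebius_cast_le_one n
      rw [Complex.norm_cpow_eq_rpow_re_of_pos (by positivity)]
      have h2 : (-((2 : ℂ) + y * Complex.I)).re = -2 := by simp
      rw [h2, Real.rpow_neg (by positivity), Real.rpow_two, div_pow, inv_div]
      calc _ ≤ 1 * ((N : ℝ) ^ 2 / (n : ℝ) ^ 2) := by gcongr
        _ = _ := by ring
  have hcont : ∀ n, Continuous (F n) := fun n => by
    rcases Nat.eq_zero_or_pos n with rfl | hn
    · simpa [hFdef] using continuous_const
    · have hn0 : (0 : ℝ) < n := by exact_mod_cast hn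
      have hne : (((n : ℝ) / N : ℝ) : ℂ) ≠ 0 := by
        exact_mod_cast (div_pos hn0 hN0).ne'
      refine continuous_const.mul (Continuous.mul ?_ ?_)
      · exact Continuous.const_cpow (by fun_prop) (Or.inl hne)
      · exact Continuous.inv₀ (by fun_prop) fun y =>
          mul_ne_zero (two_add_mul_I_ne_zero y) (two_add_mul_I_add_one_ne_zero y)
  have hmaj : ∀ n : ℕ, Integrable fun y : ℝ => (N : ℝ) ^ 2 * (1 / (n : ℝ) ^ 2) *
      ‖(((2 : ℂ) + y * Complex.I) * ((2 : ℂ) + y * Complex.I + 1))⁻¹‖ := fun n =>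
    integrable_inv_mul_add_one.norm.const_mul _
  have hint : ∀ n, Integrable (F n) := fun n =>
    (hmaj n).mono' (hcont n).aestronglyMeasurable (Eventually.of_forall (hnorm n))
  have hsumm : Summable fun n => ∫ y, ‖F n y‖ := by
    have h : Summable fun n : ℕ => (N : ℝ) ^ 2 * (1 / (n : ℝ) ^ 2) *
        ∫ y : ℝ, ‖(((2 : ℂ) + y * Complex.I) * ((2 : ℂ) + y * Complex.I + 1))⁻¹‖ :=
      ((Real.summable_one_div_nat_pow.mpr one_lt_two).mul_left _).mul_right _
    refine h.of_nonneg_of_le (fun n => integral_nonneg fun y => norm_nonneg _) fun n => ?_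
    rw [← integral_const_mul]
    exact integral_mono (hint n).norm (hmaj n) (hnorm n)
  have h1 := hasSum_integral_of_summable_integral_norm hint hsumm
  have hF : ∀ y : ℝ, ∑' n, F n y = (N : ℂ) ^ ((2 : ℂ) + y * Complex.I) *
      (((2 : ℂ) + y * Complex.I) * ((2 : ℂ) + y * Complex.I + 1))⁻¹ *
      (((2 : ℂ) + y * Complex.I - 1) / riemannZeta₁ ((2 : ℂ) + y * Complex.I)) := fun y => by
    rw [sub_one_div_riemannZeta₁_eq (by simp), LSeries, ← tsum_mul_left]
    congr 1
    funext n
    rcases Nat.eq_zero_or_pos n with rfl | hn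
    · simp [hFdef]
    · have hn0 : (0 : ℝ) < n := by exact_mod_cast hn
      rw [LSeries.term_of_ne_zero hn.ne', hFdef]
      have : (((n : ℝ) / N : ℝ) : ℂ) ^ (-((2 : ℂ) + y * Complex.I)) =
          (N : ℂ) ^ ((2 : ℂ) + y * Complex.I) / (n : ℂ) ^ ((2 : ℂ) + y * Complex.I) := by
        have h := Complex.mul_cpow_ofReal_nonneg (div_nonneg hn0.le hN0.le) hN0.le
          (-((2 : ℂ) + y * Complex.I))
        rw [← Complex.ofReal_mul, div_mul_cancel₀ _ hN0.ne', Complex.cpow_neg, Complex.cpow_neg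
          ((N : ℝ) : ℂ)] at h
        have hN1 : (((N : ℝ) : ℂ)) ^ ((2 : ℂ) + y * Complex.I) ≠ 0 := by
          rw [Complex.cpow_ne_zero_iff]
          exact Or.inl (by exact_mod_cast hN0.ne')
        rw [eq_mul_inv_iff_mul_eq₀ hN1] at h
        rw [← h, Complex.ofReal_natCast, Complex.ofReal_natCast]
        ring
      simp only [this]
      ring
  have hval : ∀ n, ∫ y, F n y = 2 * Real.pi *
      (((ArithmeticFunction.moebius n : ℝ) * max 0 (1 - (n : ℝ) / N) : ℝ) : ℂ) := fun n => by
    rcases Nat.eq_zero_or_pos n with rfl | hn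
    · simp [hFdef]
    · have hn0 : (0 : ℝ) < n := by exact_mod_cast hn
      rw [hFdef]
      simp only
      rw [integral_const_mul, integral_cpow_neg_mul_inv_mul_add_one (div_pos hn0 hN0)]
      push_cast
      ring
  simp_rw [hF] at h1
  simp_rw [hval] at h1
  refine h1.unique ?_
  rw [Complex.ofReal_sum, Finset.mul_sum]
  have e : ∀ n ∈ Finset.Icc 1 N, (2 * Real.pi : ℂ) *
      (((ArithmeticFunction.moebius n : ℝ) * (1 - (n : ℝ) / N) : ℝ) : ℂ) = 2 * Real.pi *
      (((ArithmeticFunction.moebius n : ℝ) * max 0 (1 - (n : ℝ) / N) : ℝ) : ℂ) := fun n hn => by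
    have : (n : ℝ) / N ≤ 1 := div_le_one_of_le₀ (by exact_mod_cast (Finset.mem_Icc.mp hn).2) hN0.le
    rw [max_eq_right (by linarith)]
  rw [Finset.sum_congr rfl e]
  refine hasSum_sum_of_ne_finset_zero fun n hn => ?_
  rcases Nat.eq_zero_or_pos n with rfl | hn1
  · simp
  · have : N < n := by
      by_contra! h
      exact hn (Finset.mem_Icc.mpr ⟨hn1, h⟩)
    have : (1 : ℝ) ≤ (n : ℝ) / N := (one_le_div₀ hN0).mpr (by exact_mod_cast this.le)
    rw [max_eq_left (by linarith)]
    simp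

/-! ### Unsmoothing by a unit difference, and the bound for the Mertens function -/

/-- Each weight `N - n` grows by exactly 1, and the new term `n = N + 1` has weight 0, so the
difference loses nothing. -/
theorem mertens_natCast_eq_sub (N : ℕ) :
    mertens (N : ℝ) =
      (∑ n ∈ Finset.Icc 1 (N + 1), (ArithmeticFunction.moebius n : ℝ) * ((N + 1 : ℕ) - n)) -
        ∑ n ∈ Finset.Icc 1 N, (ArithmeticFunction.moebius n : ℝ) * (N - n) := by
  rw [Finset.sum_Icc_succ_top (by omega), mertens, Nat.floor_natCast, sub_self, mul_zero, add_zero,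
    ← Finset.sum_sub_distrib]
  refine Finset.sum_congr rfl fun n _ => ?_
  push_cast
  ring

theorem norm_add_one_cpow_sub_cpow_le {s : ℂ} (hs : 0 ≤ s.re) {N : ℕ} (hN : 0 < N) :
    ‖((N + 1 : ℕ) : ℂ) ^ (s + 1) - (N : ℂ) ^ (s + 1)‖ ≤ ‖s + 1‖ * (2 * N : ℝ) ^ s.re := by
  have hN1 : (1 : ℝ) ≤ N := by exact_mod_cast hN
  have hd : ∀ t ∈ Set.Icc (N : ℝ) (N + 1), HasDerivWithinAt (fun t : ℝ => (t : ℂ) ^ (s + 1))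
      ((s + 1) * (t : ℂ) ^ s) (Set.Icc (N : ℝ) (N + 1)) t := fun t ht => by
    have ht0 : 0 < t := by have := ht.1; linarith
    have h := ((hasDerivAt_id (t : ℂ)).cpow_const (c := s + 1)
      (Or.inl (by simpa using ht0))).comp_ofReal
    simpa using h.hasDerivWithinAt
  have h := (convex_Icc (N : ℝ) (N + 1)).norm_image_sub_le_of_norm_hasDerivWithin_le
    (C := ‖s + 1‖ * (2 * N : ℝ) ^ s.re) hd (fun t ht => by
      have ht0 : 0 < t := by have := ht.1; linarith
      rw [norm_mul, Complex.norm_cpow_eq_rpow_re_of_pos ht0]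
      gcongr
      linarith [ht.2])
    (Set.left_mem_Icc.mpr (by linarith)) (Set.right_mem_Icc.mpr (by linarith))
  simpa using h

theorem norm_add_one_cpow_sub_cpow_le_two_mul {s : ℂ} (hs : 0 ≤ s.re) {N : ℕ} (hN : 0 < N) :
    ‖((N + 1 : ℕ) : ℂ) ^ (s + 1) - (N : ℂ) ^ (s + 1)‖ ≤ 2 * (2 * N : ℝ) ^ (s.re + 1) := by
  have hN1 : (1 : ℝ) ≤ N := by exact_mod_cast hN
  refine (norm_sub_le _ _).trans ?_
  rw [Complex.norm_natCast_cpow_of_pos (by omega), Complex.norm_natCast_cpow_of_pos hN,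
    Complex.add_re, Complex.one_re, two_mul]
  gcongr
  · push_cast
    linarith
  · linarith

/-- Geometric mean of the mean value bound and the trivial one. After division by `s (s + 1)` the
first alone decays only like `1/|s|`, and the second costs a full power of `N`; mixing pays `N^κ`
for an extra decay `|s|^{-κ}`. -/
theorem norm_add_one_cpow_sub_cpow_le_rpow {s : ℂ} (hs : 0 ≤ s.re) {N : ℕ} (hN : 0 < N) {κ : ℝ}
    (hκ : 0 ≤ κ) (hκ1 : κ ≤ 1) :
    ‖((N + 1 : ℕ) : ℂ) ^ (s + 1) - (N : ℂ) ^ (s + 1)‖ ≤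
      2 * ‖s + 1‖ ^ (1 - κ) * (2 * N : ℝ) ^ (s.re + κ) := by
  have hN0 : (0 : ℝ) < 2 * N := by positivity
  set x := ‖((N + 1 : ℕ) : ℂ) ^ (s + 1) - (N : ℂ) ^ (s + 1)‖
  have hx : 0 ≤ x := norm_nonneg _
  have h2 : (2 : ℝ) ^ κ ≤ 2 := by
    simpa using Real.rpow_le_rpow_of_exponent_le one_le_two hκ1
  calc x = x ^ (1 - κ) * x ^ κ := by
        rw [← Real.rpow_add' hx (by simp), sub_add_cancel, Real.rpow_one]
    _ ≤ (‖s + 1‖ * (2 * N : ℝ) ^ s.re) ^ (1 - κ) * (2 * (2 * N : ℝ) ^ (s.re + 1)) ^ κ := by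
        have h1κ : 0 ≤ 1 - κ := by linarith
        gcongr
        · exact norm_add_one_cpow_sub_cpow_le hs hN
        · exact norm_add_one_cpow_sub_cpow_le_two_mul hs hN
    _ = 2 ^ κ * ‖s + 1‖ ^ (1 - κ) * (2 * N : ℝ) ^ (s.re + κ) := by
        rw [Real.mul_rpow (norm_nonneg (s + 1)) (Real.rpow_nonneg hN0.le s.re),
          Real.mul_rpow two_pos.le (Real.rpow_nonneg hN0.le (s.re + 1)),
          ← Real.rpow_mul hN0.le, ← Real.rpow_mul hN0.le,
          show s.re + κ = s.re * (1 - κ) + (s.re + 1) * κ by ring, Real.rpow_add hN0]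
        ring
    _ ≤ _ := by gcongr

theorem one_add_abs_im_le {s : ℂ} (hs : 1 / 2 ≤ s.re) : 1 + |s.im| ≤ 3 * ‖s‖ := by
  have h1 := (le_abs_self _).trans (Complex.abs_re_le_norm s)
  have h2 := Complex.abs_im_le_norm s
  linarith

/-- Of the extra decay `κ`, half pays for the growth of `z` and half remains for integrability. The
constant is `18 = 2 * 3 * 3`. -/
theorem norm_perron_kernel_mul_le {s z : ℂ} {C κ : ℝ} (hs : 1 / 2 ≤ s.re) (hκ : 0 < κ)
    (hκ1 : κ ≤ 1) (hz : ‖z‖ ≤ C * (1 + |s.im|) ^ (κ / 2)) {N : ℕ} (hN : 0 < N) :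
    ‖(((N + 1 : ℕ) : ℂ) ^ (s + 1) - (N : ℂ) ^ (s + 1)) * (s * (s + 1))⁻¹ * z‖ ≤
      18 * C * (2 * N : ℝ) ^ (s.re + κ) * (1 + |s.im|) ^ (-(1 + κ / 2)) := by
  set u := 1 + |s.im|
  have hu0 : 0 < u := by positivity
  have hC : 0 ≤ C := by
    by_contra! h
    have : 0 < u ^ (κ / 2) := by positivity
    nlinarith [norm_nonneg z]
  have hs3 : u ≤ 3 * ‖s‖ := one_add_abs_im_le hs
  have hss : ‖s‖ ≤ ‖s + 1‖ := norm_le_norm_add_one (by linarith)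
  have hs0 : 0 < ‖s‖ := by linarith
  have hs10 : 0 < ‖s + 1‖ := by linarith
  have e1 : ‖s + 1‖ ^ (1 - κ) * ‖s + 1‖⁻¹ = (‖s + 1‖⁻¹) ^ κ := by
    rw [Real.rpow_sub hs10, Real.rpow_one, Real.inv_rpow hs10.le]
    field_simp
  have h3κ : (3 : ℝ) ^ κ ≤ 3 := by
    simpa using Real.rpow_le_rpow_of_exponent_le (by norm_num : (1 : ℝ) ≤ 3) hκ1
  have hinv : ‖s‖⁻¹ ≤ 3 * u⁻¹ := by
    rw [← div_eq_mul_inv, inv_le_comm₀ hs0 (by positivity), inv_div]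
    linarith
  have hinv1 : ‖s + 1‖⁻¹ ≤ 3 * u⁻¹ := (inv_anti₀ hs0 hss).trans hinv
  rw [norm_mul, norm_mul, norm_inv, norm_mul, mul_inv]
  calc _ ≤ (2 * ‖s + 1‖ ^ (1 - κ) * (2 * N : ℝ) ^ (s.re + κ)) * (‖s‖⁻¹ * ‖s + 1‖⁻¹) *
        (C * u ^ (κ / 2)) := by
        gcongr
        exact norm_add_one_cpow_sub_cpow_le_rpow (by linarith) hN hκ.le hκ1
    _ = 2 * C * (2 * N : ℝ) ^ (s.re + κ) * ((‖s + 1‖⁻¹) ^ κ * ‖s‖⁻¹ * u ^ (κ / 2)) := by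
        rw [← e1]
        ring
    _ ≤ 2 * C * (2 * N : ℝ) ^ (s.re + κ) * ((3 * u⁻¹) ^ κ * (3 * u⁻¹) * u ^ (κ / 2)) := by
        gcongr
    _ = 2 * C * (2 * N : ℝ) ^ (s.re + κ) * (3 ^ κ * 3 * u ^ (-(1 + κ / 2))) := by
        have : u ^ (-(1 + κ / 2)) = (u⁻¹) ^ κ * u⁻¹ * u ^ (κ / 2) := by
          rw [← Real.rpow_neg_one u, ← Real.rpow_mul hu0.le, ← Real.rpow_add hu0,
            ← Real.rpow_add hu0]
          congr 1
          ring
        rw [Real.mul_rpow (by norm_num : (0 : ℝ) ≤ 3) (inv_nonneg.mpr hu0.le), this]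
        ring
    _ ≤ 2 * C * (2 * N : ℝ) ^ (s.re + κ) * (3 * 3 * u ^ (-(1 + κ / 2))) := by gcongr
    _ = _ := by ring

/-- Multiplying the smoothed formula at `m` by `m` turns `1 - n/m` into `m - n` and `m^s` into
`m^{s+1}`; then subtract `m = N` from `m = N + 1`. -/
theorem mertens_natCast_eq_integral {N : ℕ} (hN : 0 < N) :
    ∫ y : ℝ, (((N + 1 : ℕ) : ℂ) ^ ((2 : ℂ) + y * Complex.I + 1) -
        (N : ℂ) ^ ((2 : ℂ) + y * Complex.I + 1)) *
      (((2 : ℂ) + y * Complex.I) * ((2 : ℂ) + y * Complex.I + 1))⁻¹ *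
      (((2 : ℂ) + y * Complex.I - 1) / riemannZeta₁ ((2 : ℂ) + y * Complex.I)) =
      2 * Real.pi * (mertens (N : ℝ) : ℂ) := by
  obtain ⟨K, -, hK⟩ := exists_norm_riemannZeta_le (by norm_num : (1 : ℝ) < 3 / 2)
  have hint : ∀ m : ℕ, 0 < m → MeasureTheory.Integrable fun y : ℝ =>
      (m : ℂ) ^ ((2 : ℂ) + y * Complex.I) *
        (((2 : ℂ) + y * Complex.I) * ((2 : ℂ) + y * Complex.I + 1))⁻¹ *
        (((2 : ℂ) + y * Complex.I - 1) / riemannZeta₁ ((2 : ℂ) + y * Complex.I)) := fun m hm => by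
    have hm0 : (m : ℂ) ≠ 0 := by exact_mod_cast hm.ne'
    have hζ : ∀ y : ℝ, riemannZeta₁ ((2 : ℂ) + y * Complex.I) ≠ 0 := fun y =>
      riemannZeta₁_ne_zero_of_riemannZeta_ne_zero fun _ =>
        riemannZeta_ne_zero_of_one_lt_re (by simp)
    have hζc : Continuous fun y : ℝ => riemannZeta₁ ((2 : ℂ) + y * Complex.I) :=
      differentiable_riemannZeta₁.continuous.comp (by fun_prop)
    refine ((integrable_inv_mul_add_one.norm.const_mul ((m : ℝ) ^ 2)).mul_const K).mono'
      (Continuous.aestronglyMeasurable ?_) (Eventually.of_forall fun y => ?_)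
    · refine (Continuous.mul ?_ ?_).mul (Continuous.div (by fun_prop) hζc hζ)
      · exact Continuous.const_cpow (by fun_prop) (Or.inl hm0)
      · exact Continuous.inv₀ (by fun_prop) fun y =>
          mul_ne_zero (two_add_mul_I_ne_zero y) (two_add_mul_I_add_one_ne_zero y)
    · rw [norm_mul, norm_mul, Complex.norm_natCast_cpow_of_pos hm]
      have h2 : ((2 : ℂ) + y * Complex.I).re = 2 := by simp
      rw [h2, Real.rpow_two]
      gcongr
      have h1 : (2 : ℂ) + y * Complex.I ≠ 1 := fun h => by
        have := congrArg Complex.re h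
        norm_num at this
      have := (hK ((2 : ℂ) + y * Complex.I) (by rw [h2]; norm_num)).2
      rwa [riemannZeta_eq_inv_sub_mul h1, mul_inv, inv_inv, ← div_eq_mul_inv] at this
  have hA : ∀ m : ℕ, 0 < m → ∫ y : ℝ, (m : ℂ) * ((m : ℂ) ^ ((2 : ℂ) + y * Complex.I) *
        (((2 : ℂ) + y * Complex.I) * ((2 : ℂ) + y * Complex.I + 1))⁻¹ *
        (((2 : ℂ) + y * Complex.I - 1) / riemannZeta₁ ((2 : ℂ) + y * Complex.I))) =
      2 * Real.pi *
        ((∑ n ∈ Finset.Icc 1 m, (ArithmeticFunction.moebius n : ℝ) * (m - n) : ℝ) : ℂ) :=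
    fun m hm => by
      rw [MeasureTheory.integral_const_mul, integral_cpow_mul_sub_one_div_riemannZeta₁ hm,
        mul_left_comm, ← Complex.ofReal_natCast, ← Complex.ofReal_mul, Finset.mul_sum]
      congr 2
      refine Finset.sum_congr rfl fun n _ => ?_
      have : (m : ℝ) ≠ 0 := by positivity
      field_simp
  rw [mertens_natCast_eq_sub, Complex.ofReal_sub, mul_sub, ← hA (N + 1) (by omega), ← hA N hN,
    ← MeasureTheory.integral_sub ((hint (N + 1) (by omega)).const_mul _) ((hint N hN).const_mul _)]
  congr 1
  funext y
  have hpow : ∀ m : ℕ, 0 < m → (m : ℂ) ^ ((2 : ℂ) + y * Complex.I + 1) =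
      (m : ℂ) ^ ((2 : ℂ) + y * Complex.I) * m := fun m hm => by
    rw [Complex.cpow_add _ _ (by exact_mod_cast hm.ne'), Complex.cpow_one]
  rw [hpow N hN, hpow (N + 1) N.succ_pos]
  ring

theorem exists_abs_mertens_natCast_le {η σ κ : ℝ} (hη : 1 / 2 ≤ η) (hσ : η < σ)
    (hσ1 : σ < 1) (hζ : ∀ s : ℂ, s ≠ 1 → η < s.re → riemannZeta s ≠ 0) (hκ : 0 < κ)
    (hκ1 : κ ≤ 1) : ∃ C : ℝ, ∀ N : ℕ, 0 < N → |mertens (N : ℝ)| ≤ C * (N : ℝ) ^ (σ + κ) := by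
  obtain ⟨C, hC, hb⟩ := exists_norm_sub_one_div_riemannZeta₁_le hη hσ hσ1 hζ (half_pos hκ)
  set J := ∫ y : ℝ, (1 + |y|) ^ (-(1 + κ / 2)) with hJ
  refine ⟨18 * C * 2 ^ (σ + κ) * J / (2 * Real.pi), fun N hN => ?_⟩
  have hN1 : (1 : ℝ) ≤ 2 * N := by
    have : (1 : ℝ) ≤ N := by exact_mod_cast hN
    linarith
  set F : ℂ → ℂ := fun s => (((N + 1 : ℕ) : ℂ) ^ (s + 1) - (N : ℂ) ^ (s + 1)) *
    (s * (s + 1))⁻¹ * ((s - 1) / riemannZeta₁ s) with hF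
  have hFb : ∀ s : ℂ, σ ≤ s.re → s.re ≤ 2 →
      ‖F s‖ ≤ 18 * C * (2 * N : ℝ) ^ (s.re + κ) * (1 + |s.im|) ^ (-(1 + κ / 2)) :=
    fun s hs hs2 => norm_perron_kernel_mul_le (by linarith) hκ hκ1 (hb s hs hs2) hN
  have hFd : DifferentiableOn ℂ F {s | σ ≤ s.re ∧ s.re ≤ 2} := fun s hs => by
    have hs0 : 0 < s.re := by have := hs.1; linarith
    have h1 : s ≠ 0 := by rintro rfl; simp at hs0
    have h2 : s + 1 ≠ 0 := fun h => by
      have := congrArg Complex.re h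
      simp at this
      linarith
    have h3 : riemannZeta₁ s ≠ 0 := riemannZeta₁_ne_zero_of_riemannZeta_ne_zero fun h =>
      hζ s h (hσ.trans_le hs.1)
    have h4 : (N : ℂ) ≠ 0 := by exact_mod_cast hN.ne'
    have h5 : ((N + 1 : ℕ) : ℂ) ≠ 0 := by exact_mod_cast N.succ_ne_zero
    have hadd : DifferentiableAt ℂ (fun s : ℂ => s + 1) s := by fun_prop
    refine DifferentiableAt.differentiableWithinAt (DifferentiableAt.mul (DifferentiableAt.mul
      ((hadd.const_cpow (Or.inl h5)).sub (hadd.const_cpow (Or.inl h4)))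
      (DifferentiableAt.inv (by fun_prop) (mul_ne_zero h1 h2)))
      (DifferentiableAt.div (by fun_prop) differentiable_riemannZeta₁.differentiableAt h3))
  -- This constant, uniform over the strip, only justifies the shift; the final estimate uses `hFb`
  -- on `Re s = σ`.
  have hshift := integral_vertical_line_eq (F := F) (a := σ) (b := 2) (κ := κ / 2)
    (C := 18 * C * (2 * N : ℝ) ^ (2 + κ)) (by linarith) (half_pos hκ) hFd
    fun s hs hs2 => (hFb s hs hs2).trans (by gcongr)
  have hM : ∫ y : ℝ, F (σ + y * Complex.I) = 2 * Real.pi * (mertens (N : ℝ) : ℂ) := by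
    rw [hshift, ← mertens_natCast_eq_integral hN]
    simp only [hF, Complex.ofReal_ofNat]
  have hnorm : ‖∫ y : ℝ, F (σ + y * Complex.I)‖ ≤ 18 * C * (2 * N : ℝ) ^ (σ + κ) * J := by
    rw [hJ, ← MeasureTheory.integral_const_mul]
    refine MeasureTheory.norm_integral_le_of_norm_le ?_ (Eventually.of_forall fun y => ?_)
    · have h : MeasureTheory.Integrable fun y : ℝ => (1 + ‖y‖) ^ (-(1 + κ / 2)) :=
        integrable_one_add_norm (by simpa using hκ)
      exact h.const_mul _
    · simpa using hFb (σ + y * Complex.I) (by simp) (by simp; linarith)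
  rw [hM, norm_mul, Complex.norm_real, Real.norm_eq_abs, Real.mul_rpow two_pos.le (by positivity)]
    at hnorm
  have hπ : ‖(2 * Real.pi : ℂ)‖ = 2 * Real.pi := by
    simp [abs_of_pos Real.pi_pos]
  rw [hπ] at hnorm
  rw [div_mul_eq_mul_div, le_div_iff₀ (by positivity)]
  linarith

theorem mertens_isBigO_of_riemannZeta_ne_zero {η ε : ℝ} (hη : 1 / 2 ≤ η) (hη1 : η < 1)
    (hζ : ∀ s : ℂ, s ≠ 1 → η < s.re → riemannZeta s ≠ 0) (hε : 0 < ε) :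
    mertens =O[atTop] fun x : ℝ => x ^ (η + ε) := by
  -- `δ` is spent twice, on `σ = η + δ` and on `κ = δ`; the second bound keeps `σ < 1`.
  set δ := min (ε / 2) ((1 - η) / 2)
  have hδ0 : 0 < δ := lt_min (by linarith) (by linarith)
  have hδ1 : δ ≤ (1 - η) / 2 := min_le_right _ _
  have hδ2 : δ ≤ ε / 2 := min_le_left _ _
  obtain ⟨C, hC⟩ := exists_abs_mertens_natCast_le hη (σ := η + δ) (κ := δ) (by linarith)
    (by linarith) hζ hδ0 (by linarith)
  have hC0 : 0 ≤ C := by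
    have := (abs_nonneg _).trans (hC 1 one_pos)
    simpa using this
  refine IsBigO.of_bound C ?_
  filter_upwards [eventually_ge_atTop 1] with x hx
  have hfl : mertens x = mertens (⌊x⌋₊ : ℝ) := by simp [mertens]
  rw [Real.norm_eq_abs, Real.norm_of_nonneg (by positivity), hfl]
  calc |mertens (⌊x⌋₊ : ℝ)| ≤ C * (⌊x⌋₊ : ℝ) ^ (η + δ + δ) := hC _ (Nat.floor_pos.mpr hx)
    _ ≤ C * x ^ (η + δ + δ) := mul_le_mul_of_nonneg_left (Real.rpow_le_rpow (Nat.cast_nonneg _)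
      (Nat.floor_le (by linarith)) (by linarith)) hC0
    _ ≤ C * x ^ (η + ε) := mul_le_mul_of_nonneg_left
      (Real.rpow_le_rpow_of_exponent_le hx (by linarith)) hC0

theorem mainTheorem4 (η : ℝ) (hη : 1 / 2 ≤ η) (hη1 : η < 1) :
    List.TFAE [
      ∀ s : ℂ, s ≠ 1 → η < s.re → riemannZeta s ≠ 0,
      ∀ ε : ℝ, 0 < ε → mertens =O[atTop] fun x : ℝ => x ^ (η + ε),
      ∀ ε : ℝ, 0 < ε →
        moebiusPowerSeries =O[𝓝[<] (1 : ℝ)] fun z : ℝ => (1 - z) ^ (-(η + ε))] := by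
  tfae_have 1 → 2 := fun h ε hε => mertens_isBigO_of_riemannZeta_ne_zero hη hη1 h hε
  tfae_have 2 → 3 := fun h ε hε => by
    -- The Abelian lemma needs an exponent at most 1, so `ε` is capped at `1 - η`.
    have h0 : 0 < min ε (1 - η) := lt_min hε (by linarith)
    refine (moebiusPowerSeries_isBigO_of_mertens_isBigO (a := η + min ε (1 - η)) (by linarith)
      (by linarith [min_le_right ε (1 - η)]) (h _ h0)).trans
      (one_sub_rpow_neg_isBigO (by linarith [min_le_left ε (1 - η)]))
  tfae_have 3 → 1 := riemannZeta_ne_zero_of_moebiusPowerSeries_isBigO (by linarith) hη1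
  tfae_finish
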